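/- Let $1\le k\le \min(m,n)$ and let $D=n^m\setminus(k^{k-1},k-1)$ be the left-justified array of boxes with $m$ rows, whose rows $1,\dots,k-1$ have $n-k$ boxes, whose row $k$ has $n-k+1$ boxes and whose remaining rows have $n$ boxes (the $m\times n$ rectangle with a $k\times k$ square minus its lower left corner box removed from its upper right corner). A standard tableau of shape $D$ is a filling of $D$ with $1,2,\dots,|D|=nm-k^2+1$, each used once, increasing along rows and down columns; $f_\lambda$ denotes the number of standard Young tableaux of partition shape $\lambda$. Then the number of standard tableaux of shape $D$ is $$\binom{nm-k^2+1}{m(n-k)}\binom{k(m+n-2k)+1}{kn-k^2}^{-1} f_{(m^{n-k})}\, f_{((m-k)^k)}.$$ Suppose moreover that $n\ge 2k-1$. Let $F_D(q)=\sum_T q^{\sum T[i,j]}$, the sum over all plane partitions $T$ of shape $D$, i.e. fillings of $D$ with nonnegative integers weakly decreasing along rows and down columns, and let $a_r(q)$ be the coefficients of $$f_q(v)=v^{\binom k2}\prod_{1\le i\le k<j\le m}\left(vq^{m-i}-q^{m-j}\right)=\sum_r a_r(q)v^r.$$ Then, for every complex $q$ with $0<|q|<1$, the series $F_D(q)$ converges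 absolutely and $$F_D(q)=\sum_r \frac{a_r(q)}{1-q^{\,r+kn-k^2-\binom{k}{2}+1}}\ \prod_{\substack{m-k\le i<m\\ 0\le j<m-k}}\frac1{q^i-q^j}\ \prod_{\substack{0\le i\le m-1\\ 1\le j\le n-k}}\frac1{1-q^{i+j}},$$ and the number of standard tableaux of shape $D$ equals $$\frac{(nm-k^2+1)!\,f_{(m^{n-k})}}{(m(n-k))!}\cdot\frac{f_{((m-k)^k)}}{((m-k)k)!}\cdot\frac{(kn-k^2)!\,(k(m-k))!}{(mk+kn-2k^2+1)!}.$$ -/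

import Mathlib

open scoped Nat

/-- The straight diagram of truncated shape `lam ∖ mu`: the left-justified array of boxes
`(i, j)` (rows and columns numbered from `0`) whose row `i` has `lam i - mu i` boxes.
Missing parts of `lam` and `mu` are read as `0`. -/
def truncatedDiagram (lam mu : List ℕ) : Finset (ℕ × ℕ) :=
  (Finset.range lam.length).biUnion fun i =>
    (Finset.range (lam.getD i 0 - mu.getD i 0)).image fun j => (i, j)

theorem mem_truncatedDiagram (lam mu : List ℕ) (c : ℕ × ℕ) :
    c ∈ truncatedDiagram lam mu ↔ c.2 < lam.getD c.1 0 - mu.getD c.1 0 := by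
  obtain ⟨i, j⟩ := c
  simp only [truncatedDiagram, Finset.mem_biUnion, Finset.mem_range, Finset.mem_image,
    Prod.mk.injEq]
  constructor
  · rintro ⟨i', -, j', hj, rfl, rfl⟩
    exact hj
  · intro h
    refine ⟨i, ?_, j, h, rfl, rfl⟩
    by_contra hi
    rw [List.getD_eq_default _ _ (not_lt.mp hi), Nat.zero_sub] at h
    exact Nat.not_lt_zero _ h

/-- The ordinary Young diagram of the partition `lam`. -/
def straightDiagram (lam : List ℕ) : Finset (ℕ × ℕ) :=
  truncatedDiagram lam []

/-- The rectangle `n^m` (`m` rows of length `n`) truncated by the `k × k` square without its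
corner box, i.e. the truncated shape `n^m ∖ (k^(k-1), k-1)`. -/
def almostSquareDiagram (m n k : ℕ) : Finset (ℕ × ℕ) :=
  truncatedDiagram (List.replicate m n) (List.replicate (k - 1) k ++ [k - 1])

/-- A filling of `D` with the integers `1, …, |D|`, each used exactly once, is a standard
tableau if the entries increase across rows and down columns. -/
def IsStandardTableau (D : Finset (ℕ × ℕ)) (T : D ≃ Finset.Icc 1 D.card) : Prop :=
  (∀ a b : D, a.1.1 = b.1.1 → a.1.2 < b.1.2 → (T a : ℕ) < T b) ∧
    (∀ a b : D, a.1.2 = b.1.2 → a.1.1 < b.1.1 → (T a : ℕ) < T b)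

/-- The number of standard tableaux of shape `D`. -/
noncomputable def numStandardTableaux (D : Finset (ℕ × ℕ)) : ℕ :=
  Nat.card {T : D ≃ Finset.Icc 1 D.card // IsStandardTableau D T}

/-- A plane partition of shape `D`: a filling of `D` with nonnegative integers which weakly
decrease along rows and down columns. -/
def IsPlanePartition (D : Finset (ℕ × ℕ)) (T : D → ℕ) : Prop :=
  (∀ a b : D, a.1.1 = b.1.1 → a.1.2 < b.1.2 → T b ≤ T a) ∧
    (∀ a b : D, a.1.2 = b.1.2 → a.1.1 < b.1.1 → T b ≤ T a)

/-- The polynomial `f_q(v) = v^(k choose 2) ∏_{1 ≤ i ≤ k < j ≤ m} (v q^(m-i) - q^(m-j))`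
in the variable `v`; its coefficient at `v^r` is `a_r(q)`. -/
noncomputable def almostSquarePoly (m k : ℕ) (q : ℂ) : Polynomial ℂ :=
  Polynomial.X ^ k.choose 2 *
    ∏ i ∈ Finset.Icc 1 k, ∏ j ∈ Finset.Icc (k + 1) m,
      (Polynomial.X * Polynomial.C (q ^ (m - i)) - Polynomial.C (q ^ (m - j)))

/-- The rational function
`∑_r a_r(q) / (1 - q^(r + kn - k² - (k choose 2) + 1))
  · ∏_{m-k ≤ i < m, 0 ≤ j < m-k} 1 / (q^i - q^j) · ∏_{0 ≤ i ≤ m-1, 1 ≤ j ≤ n-k} 1 / (1 - q^(i+j))`.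
-/
noncomputable def almostSquareGF (m n k : ℕ) (q : ℂ) : ℂ :=
  (∑ r ∈ Finset.range ((almostSquarePoly m k q).natDegree + 1),
      (almostSquarePoly m k q).coeff r *
        (1 / (1 - q ^ ((r : ℤ) + k * n - k ^ 2 - k.choose 2 + 1)))) *
    (∏ i ∈ Finset.Ico (m - k) m, ∏ j ∈ Finset.range (m - k), 1 / (q ^ i - q ^ j)) *
    ∏ i ∈ Finset.range m, ∏ j ∈ Finset.Icc 1 (n - k), 1 / (1 - q ^ (i + j))

/-! Put $s=n-k$ and let $c$ be the entry of the corner box left in row $k$ (the pivot). Writing $c$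
to the right of $D$ in the first $k$ rows and $0$ to the right in the rows below keeps the filling
weakly decreasing, and the diagonal $j=i+s$ (indices from $0$) becomes $(c^k,0^{m-k})$. Conversely,
that diagonal forces every added entry by squeezing. So $F_D$ is a sum over $c$ of generating
functions of arrays below a prescribed diagonal $\mu=(c^k,0^{m-k})$, corrected by the weight of the
added boxes.

These are computed one diagonal at a time. Consecutive diagonals interlace; for a fixed outer
diagonal this constrains each entry of the next one separately, so summing an alternant at powers of
$q$ amounts to summing geometric series row by row in a determinant, and row operations give back an
alternant (`hasSum_qAlternant_succ`, `hasSum_qAlternant_horizontalStrip`). Hence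
`DiagArray.hasSum_interlaces`: a product, times $q^{s|\mu|}$, times the ratio $a_\mu/a_0$, which is
the Schur function $s_\mu(1,q,\dots,q^{m-1})$. For the rectangle $\mu=(c^k)$ this ratio is
$f_q(q^c)$ times a product free of $c$, and summing over $c$ is a geometric series for each
coefficient $a_r$.

For the count, $(1-q)^{|D|}F_D(q)$ is the probability that independent geometric entries form a
plane partition. As $q\to1^-$ ties disappear and all orderings are equally likely, so it tends to
(number of standard tableaux)$/|D|!$. On the explicit side $f_q$ degenerates to $v^{\binom
k2}(v-1)^{k(m-k)}$ and the sum becomes a beta integral (`tendsto_almostSquareGF`). The case $k=1$ is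
the full rectangle and yields the hook length formula needed for $f_{(m^{n-k})}$ and
$f_{((m-k)^k)}$. -/

/-! ### Sums of products and of determinants -/

theorem HasSum.of_eq {α M : Type*} [AddCommMonoid M] [TopologicalSpace M] {f g : α → M} {a : M}
    (hf : HasSum f a) (h : ∀ x, f x = g x) : HasSum g a :=
  funext h ▸ hf

theorem HasSum.mul_prod {𝕜 α β : Type*} [RCLike 𝕜] {f : α → 𝕜} {g : β → 𝕜} {a b : 𝕜}
    (hf : HasSum f a) (hg : HasSum g b) : HasSum (fun x : α × β => f x.1 * g x.2) (a * b) := by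
  have h1 : Summable fun x => ‖f x‖ := summable_norm_iff.mpr hf.summable
  have h2 : Summable fun x => ‖g x‖ := summable_norm_iff.mpr hg.summable
  exact hf.mul hg (summable_mul_of_summable_norm h1 h2)

theorem hasSum_fin_pi_prod {𝕜 : Type*} [RCLike 𝕜] {m : ℕ} (f : Fin m → ℕ → 𝕜) (a : Fin m → 𝕜)
    (h : ∀ i, HasSum (f i) (a i)) :
    HasSum (fun l : Fin m → ℕ => ∏ i, f i (l i)) (∏ i, a i) := by
  induction m with
  | zero => simp
  | succ m ih =>
    have ih' := ih (fun i => f i.succ) (fun i => a i.succ) fun i => h i.succ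
    have hmul := (h 0).mul_prod ih'
    rw [Fin.prod_univ_succ, ← (Fin.consEquiv fun _ : Fin (m + 1) => ℕ).hasSum_iff]
    exact hmul.of_eq fun x =>
      (Fin.prod_univ_succ fun i => f i ((Fin.consEquiv fun _ : Fin (m + 1) => ℕ) x i)).symm

/-- The generating function of all fillings of a finite set. -/
theorem hasSum_pow_sum {𝕜 : Type*} [RCLike 𝕜] {ι : Type*} [Fintype ι] {q : 𝕜} (hq : ‖q‖ < 1) :
    HasSum (fun T : ι → ℕ => q ^ ∑ i, T i) ((1 - q)⁻¹ ^ Fintype.card ι) := by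
  have h := hasSum_fin_pi_prod (fun _ : Fin (Fintype.card ι) => fun l => q ^ l) _
    fun _ => hasSum_geometric_of_norm_lt_one hq
  rw [← ((Fintype.equivFin ι).symm.arrowCongr (Equiv.refl ℕ)).hasSum_iff]
  simp only [Finset.prod_pow_eq_pow_sum, Finset.prod_const, Finset.card_univ,
    Fintype.card_fin] at h
  refine h.of_eq fun T => ?_
  simp only [Function.comp_apply, Equiv.arrowCongr_apply, Equiv.symm_symm, Equiv.coe_refl, id]
  rw [← (Fintype.equivFin ι).sum_comp]

/-- A determinant is multilinear in its rows and row `i` involves only the variable `l i`, so the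
multiple sum can be taken inside, row by row. -/
theorem hasSum_det {m : ℕ} (f : Fin m → Fin m → ℕ → ℂ) (S : Matrix (Fin m) (Fin m) ℂ)
    (h : ∀ i j, HasSum (f i j) (S i j)) :
    HasSum (fun l : Fin m → ℕ => (Matrix.of fun i j => f i j (l i)).det) S.det := by
  -- After transposing, the Leibniz expansion is indexed by rows, so the factor at `i` depends on `l
  -- i` alone.
  simp only [← Matrix.det_transpose (Matrix.of _)]
  rw [← Matrix.det_transpose S]
  simp only [Matrix.det_apply', Matrix.transpose_apply, Matrix.of_apply]
  exact hasSum_sum fun σ _ => (hasSum_fin_pi_prod (fun i => f i (σ i)) _ fun i => h i (σ i)).mul_left _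

/-- A constraint imposed on each `l i` separately scales row `i` by an indicator. This is the form
in which interlacing conditions enter. -/
theorem hasSum_det_indicator {m : ℕ} (I : Fin m → ℕ → Prop) [∀ i, DecidablePred (I i)]
    (g : Fin m → Fin m → ℕ → ℂ) (S : Matrix (Fin m) (Fin m) ℂ)
    (h : ∀ i j, HasSum (fun l => if I i l then g i j l else 0) (S i j)) :
    HasSum (fun l : Fin m → ℕ =>
      if ∀ i, I i (l i) then (Matrix.of fun i j => g i j (l i)).det else 0) S.det := by
  refine (hasSum_det _ S h).of_eq fun l => ?_
  have := Matrix.det_mul_column (fun i => if I i (l i) then (1 : ℂ) else 0)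
    (Matrix.of fun i j => g i j (l i))
  simp only [Matrix.of_apply, ite_mul, one_mul, zero_mul] at this
  rw [this, Finset.prod_ite_zero]
  simp

theorem hasSum_geometric_Ici {z : ℂ} (hz : ‖z‖ < 1) (a r : ℕ) :
    HasSum (fun l => if a ≤ l then z ^ (l + r) else 0) (z ^ (a + r) * (1 - z)⁻¹) := by
  have h := (hasSum_geometric_of_norm_lt_one hz).mul_left (z ^ (a + r))
  refine ((add_left_injective a).hasSum_iff ?_).mp (h.of_eq fun l => ?_)
  · intro l hl
    rw [if_neg]
    intro hal
    exact hl ⟨l - a, by simp [hal]⟩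
  · simp only [Function.comp_apply, Nat.le_add_left, if_true]
    ring

theorem hasSum_geometric_Icc {z : ℂ} (hz : ‖z‖ < 1) {a b : ℕ} (hab : a ≤ b) (r : ℕ) :
    HasSum (fun l => if a ≤ l ∧ l ≤ b then z ^ (l + r) else 0)
      ((z ^ (a + r) - z ^ (b + r + 1)) * (1 - z)⁻¹) := by
  have h := (hasSum_geometric_Ici hz a r).sub (hasSum_geometric_Ici hz (b + 1) r)
  rw [← sub_mul, add_right_comm] at h
  refine h.of_eq fun l => ?_
  by_cases h1 : a ≤ l <;> by_cases h2 : b + 1 ≤ l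
  · simp [h1, h2, Nat.not_le.mpr h2]
  · simp [h1, h2, Nat.lt_succ_iff.mp (Nat.not_le.mp h2)]
  · omega
  · simp [h1, h2]

/-! ### Alternants at powers of q, summed over interlacing sequences -/

/-- The alternant with exponents `l i = μ i + (m - 1 - i)` at the points `1, q, …, q ^ (m - 1)`. -/
noncomputable def qAlternant (q : ℂ) {m : ℕ} (μ : Fin m → ℕ) : ℂ :=
  (Matrix.vandermonde fun i => q ^ (μ i + (i.rev : ℕ))).det

theorem norm_pow_succ_lt_one {q : ℂ} (hq : ‖q‖ < 1) (a : ℕ) : ‖q ^ (a + 1)‖ < 1 := by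
  rw [norm_pow]
  exact pow_lt_one₀ (norm_nonneg _) hq (by simp)

theorem one_sub_pow_ne_zero {q : ℂ} (hq : ‖q‖ < 1) (a : ℕ) : 1 - q ^ (a + 1) ≠ 0 := by
  intro h
  have := norm_pow_succ_lt_one hq a
  rw [← sub_eq_zero.mp h] at this
  simp at this

theorem sum_fin_rev (m : ℕ) : ∑ i : Fin m, (i.rev : ℕ) = m.choose 2 := by
  rw [show ∑ i : Fin m, (i.rev : ℕ) = ∑ i : Fin m, (i : ℕ) from
    Equiv.sum_comp Fin.revPerm (fun i : Fin m => (i : ℕ)), Fin.sum_univ_eq_sum_range (fun i => i),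
    Finset.sum_range_id, Nat.choose_two_right]

/-- Scaling an alternant by a power of `q`. -/
theorem det_pow_mul_eq (q : ℂ) {m : ℕ} (μ : Fin m → ℕ) (s : ℕ) :
    (Matrix.of fun i j : Fin m => (q ^ (s + (j : ℕ))) ^ (μ i + (i.rev : ℕ))).det =
      q ^ (s * m.choose 2) * (q ^ (s * ∑ i, μ i) * qAlternant q μ) := by
  rw [qAlternant, ← mul_assoc, ← pow_add, ← mul_add, ← sum_fin_rev, ← Finset.sum_add_distrib,
    Finset.mul_sum, ← Finset.prod_pow_eq_pow_sum, ← Matrix.det_mul_column]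
  congr 1
  ext i j
  simp only [Matrix.of_apply, Matrix.vandermonde_apply]
  rw [← pow_mul, ← pow_mul, ← pow_add]
  congr 1
  ring

/-- Adding a diagonal to a triangular array. -/
theorem hasSum_qAlternant_succ {q : ℂ} (hq : ‖q‖ < 1) {m : ℕ} (μ : Fin (m + 1) → ℕ)
    (hμ : Antitone μ) :
    HasSum (fun l : Fin m → ℕ =>
        if ∀ i, μ i.succ ≤ l i ∧ l i ≤ μ i.castSucc then
          q ^ m.choose 2 * (q ^ ∑ i, l i) * qAlternant q l else 0)
      (qAlternant q μ * ∏ j ∈ Finset.range m, (1 - q ^ (j + 1))⁻¹) := by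
  have h := hasSum_det_indicator (fun i l => μ i.succ ≤ l ∧ l ≤ μ i.castSucc)
    (fun i j l => (q ^ (1 + (j : ℕ))) ^ (l + (i.rev : ℕ)))
    (Matrix.of fun i j => (1 - q ^ ((j : ℕ) + 1))⁻¹ *
      ((q ^ ((j : ℕ) + 1)) ^ (μ i.succ + (i.succ.rev : ℕ)) -
        (q ^ ((j : ℕ) + 1)) ^ (μ i.castSucc + (i.castSucc.rev : ℕ)))) ?_
  · simp only [det_pow_mul_eq, one_mul, ← mul_assoc] at h
    convert h using 1
    refine Eq.trans ?_ (Matrix.det_mul_row (fun j : Fin m => (1 - q ^ ((j : ℕ) + 1))⁻¹)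
      fun i j => ((q ^ ((j : ℕ) + 1)) ^ (μ i.succ + (i.succ.rev : ℕ)) -
        (q ^ ((j : ℕ) + 1)) ^ (μ i.castSucc + (i.castSucc.rev : ℕ)))).symm
    rw [mul_comm,
      Fin.prod_univ_eq_prod_range (fun j => (1 - q ^ (j + 1))⁻¹)]
    congr 1
    set v : Fin (m + 1) → ℂ := fun i => q ^ (μ i + (i.rev : ℕ)) with hv
    -- Subtracting from each row its predecessor turns the first column, all ones, into `(1, 0, …,
    -- 0)`; the remaining minor is the matrix of differences.
    rw [qAlternant, Matrix.det_eq_of_forall_row_eq_smul_add_pred (B := Matrix.of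
      (Fin.cons (Matrix.vandermonde v 0) fun i j => v i.succ ^ (j : ℕ) - v i.castSucc ^ (j : ℕ)))
      (fun _ => 1) (fun j => by simp [hv]) (fun i j => by simp [hv]), Matrix.det_succ_column_zero,
      Fin.sum_univ_succ, Finset.sum_eq_zero]
    · simp only [Fin.val_zero, pow_zero, one_mul, add_zero, Matrix.of_apply, Fin.cons_zero,
        Matrix.vandermonde_apply]
      congr 1
      ext i j
      simp only [Matrix.submatrix_apply, Fin.succAbove_zero, Matrix.of_apply, Fin.cons_succ, hv,
        Fin.val_succ, ← pow_mul, mul_comm]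
    · intro i _
      simp
  · intro i j
    have hi := hasSum_geometric_Icc (norm_pow_succ_lt_one hq j)
      (hμ (Fin.castSucc_le_succ i)) (i.rev : ℕ)
    have e1 : (i.succ.rev : ℕ) = i.rev := by simp [Fin.val_rev]
    -- The staircase shift supplies exactly the `+ 1` of the geometric sum's upper end, so both ends
    -- are exponents of the alternant of `μ`.
    have e2 : (i.castSucc.rev : ℕ) = i.rev + 1 := by simp [Fin.val_rev]; omega
    rw [Matrix.of_apply, e1, e2, mul_comm, ← add_assoc]
    simpa only [add_comm 1 (j : ℕ)] using hi

/-- The one-variable skew Cauchy identity for alternants. -/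
theorem hasSum_qAlternant_horizontalStrip {q : ℂ} (hq : ‖q‖ < 1) {m : ℕ} (s : ℕ)
    (μ : Fin (m + 1) → ℕ) (hμ : Antitone μ) :
    HasSum (fun l : Fin (m + 1) → ℕ =>
        if (∀ i, μ i ≤ l i) ∧ ∀ i : Fin m, l i.succ ≤ μ i.castSucc then
          q ^ ((s + 1) * (m + 1).choose 2) * (q ^ ((s + 1) * ∑ i, l i) * qAlternant q l) else 0)
      (q ^ ((s + 1) * (m + 1).choose 2) * (q ^ ((s + 1) * ∑ i, μ i) * qAlternant q μ) *
        ∏ j ∈ Finset.range (m + 1), (1 - q ^ (j + (s + 1)))⁻¹) := by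
  set z : Fin (m + 1) → ℂ := fun j => q ^ (s + 1 + (j : ℕ)) with hz
  have hz1 : ∀ j, ‖z j‖ < 1 := fun j => by
    rw [hz]; convert norm_pow_succ_lt_one hq (s + j) using 3; ring
  have h := hasSum_det_indicator
    -- The upper bound is void for row `0`: the largest part is unbounded, so that row is a full
    -- geometric tail and the others are differences.
    (fun i l => μ i ≤ l ∧ (∀ i' : Fin m, i = i'.succ → l ≤ μ i'.castSucc))
    (fun i j l => z j ^ (l + (i.rev : ℕ)))
    (Matrix.of fun i j => (1 - z j)⁻¹ *
      (Fin.cons (fun j => z j ^ (μ 0 + ((0 : Fin (m + 1)).rev : ℕ)))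
        (fun i j => z j ^ (μ i.succ + (i.succ.rev : ℕ)) -
          z j ^ (μ i.castSucc + (i.castSucc.rev : ℕ))) : Fin (m + 1) → Fin (m + 1) → ℂ) i j) ?_
  · convert h using 1
    · funext l
      rw [det_pow_mul_eq]
      refine if_congr ⟨?_, ?_⟩ rfl rfl
      · rintro ⟨h1, h2⟩ i
        exact ⟨h1 i, fun i' hi => hi ▸ h2 i'⟩
      · intro h
        exact ⟨fun i => (h i).1, fun i => (h i.succ).2 i rfl⟩
    · refine Eq.trans ?_ (Matrix.det_mul_row (fun j => (1 - z j)⁻¹) (Fin.cons _ _)).symm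
      rw [mul_comm,
        ← Fin.prod_univ_eq_prod_range (fun j => (1 - q ^ (j + (s + 1)))⁻¹), ← det_pow_mul_eq]
      congr 1
      · simp [hz, add_comm]
      -- The differences telescope: adding to each row the row above restores the alternant of `μ`.
      · refine Matrix.det_eq_of_forall_row_eq_smul_add_pred (fun _ => 1) (fun j => ?_)
          fun i j => ?_
        · simp [hz]
        · simp [hz]
  · intro i j
    rw [Matrix.of_apply, mul_comm]
    induction i using Fin.cases with
    | zero =>
      have hi := hasSum_geometric_Ici (hz1 j) (μ 0) ((0 : Fin (m + 1)).rev : ℕ)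
      refine hi.of_eq fun l => if_congr ?_ rfl rfl
      simp [eq_comm (a := (0 : Fin (m + 1)))]
    | succ i =>
      have hi := hasSum_geometric_Icc (hz1 j) (hμ (Fin.castSucc_le_succ i)) (i.succ.rev : ℕ)
      have e2 : (i.castSucc.rev : ℕ) = i.succ.rev + 1 := by simp [Fin.val_rev]; omega
      rw [Fin.cons_succ, e2, ← add_assoc]
      refine hi.of_eq fun l => if_congr ?_ rfl rfl
      simp

/-! ### Arrays stored by diagonals and their generating functions -/

/-- Fillings of the cells `(i, j)` with `j < i < m`, stored diagonal by diagonal. -/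
def TriArray : ℕ → Type
  | 0 => Unit
  | m + 1 => (Fin m → ℕ) × TriArray m

namespace TriArray

/-- The array `x`, extended by the diagonal `μ`, decreases weakly along rows and columns. -/
def Interlaces : (m : ℕ) → (Fin m → ℕ) → TriArray m → Prop
  | 0, _, _ => True
  | m + 1, μ, x => (∀ i, μ i.succ ≤ x.1 i ∧ x.1 i ≤ μ i.castSucc) ∧ Interlaces m x.1 x.2

/-- The sum of the entries. -/
def weight : (m : ℕ) → TriArray m → ℕ
  | 0, _ => 0
  | m + 1, x => ∑ i, x.1 i + weight m x.2

/-- The restriction of a filling of the quadrant. -/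
def ofFun : (m : ℕ) → (ℕ → ℕ → ℕ) → TriArray m
  | 0, _ => ()
  | m + 1, F => (fun i => F (i + 1) i, ofFun m fun i j => F (i + 1) j)

theorem summable_pow_weight {q : ℂ} (hq : ‖q‖ < 1) :
    ∀ m, Summable fun x : TriArray m => q ^ weight m x
  | 0 => (hasSum_fintype (α := ℂ) (β := Unit) fun _ => q ^ 0).summable
  | m + 1 => by
    have h := ((hasSum_pow_sum (ι := Fin m) hq).mul_prod (summable_pow_weight hq m).hasSum)
    exact (h.of_eq fun x => (pow_add _ _ _).symm).summable

end TriArray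

/-- Fillings of the cells `(i, j)` with `i ≤ m` and `j < i + s`, stored diagonal by diagonal. -/
def DiagArray (m : ℕ) : ℕ → Type
  | 0 => TriArray (m + 1)
  | s + 1 => (Fin (m + 1) → ℕ) × DiagArray m s

namespace DiagArray

/-- The array `x`, extended by the diagonal `μ`, decreases weakly along rows and columns. -/
def Interlaces (m : ℕ) : (s : ℕ) → (Fin (m + 1) → ℕ) → DiagArray m s → Prop
  | 0, μ, x => TriArray.Interlaces (m + 1) μ x
  | s + 1, μ, x => ((∀ i, μ i ≤ x.1 i) ∧ ∀ i : Fin m, x.1 i.succ ≤ μ i.castSucc) ∧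
      Interlaces m s x.1 x.2

/-- The sum of the entries. -/
def weight (m : ℕ) : (s : ℕ) → DiagArray m s → ℕ
  | 0, x => TriArray.weight (m + 1) x
  | s + 1, x => ∑ i, x.1 i + weight m s x.2

/-- The restriction of a filling of the quadrant. -/
def ofFun (m : ℕ) : (s : ℕ) → (ℕ → ℕ → ℕ) → DiagArray m s
  | 0, F => TriArray.ofFun (m + 1) F
  | s + 1, F => (fun i => F i (i + s), ofFun m s F)

theorem summable_pow_weight {q : ℂ} (hq : ‖q‖ < 1) (m : ℕ) :
    ∀ s, Summable fun x : DiagArray m s => q ^ weight m s x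
  | 0 => TriArray.summable_pow_weight hq (m + 1)
  | s + 1 => by
    have h := ((hasSum_pow_sum (ι := Fin (m + 1)) hq).mul_prod (summable_pow_weight hq m s).hasSum)
    exact (h.of_eq fun x => (pow_add _ _ _).symm).summable

end DiagArray

theorem summable_ite_of_summable {α : Type*} {f : α → ℂ} (hf : Summable f) (P : α → Prop)
    [DecidablePred P] : Summable fun x => if P x then f x else 0 :=
  Summable.of_norm_bounded (summable_norm_iff.mpr hf) fun x => by split_ifs <;> simp

/-- Summation over a pair whose second component is constrained by the first. -/
theorem hasSum_prod_of_fiber {α β : Type*} {P : α → Prop} {Q : α → β → Prop} {f : α → ℕ}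
    {g : β → ℕ} {q : ℂ} {A : α → ℂ} {S : ℂ} [DecidablePred P] [∀ a, DecidablePred (Q a)]
    [DecidablePred fun x : α × β => P x.1 ∧ Q x.1 x.2]
    (hf : Summable fun a => q ^ f a) (hg : Summable fun b => q ^ g b)
    (h1 : ∀ a, P a → HasSum (fun b => if Q a b then q ^ g b else 0) (A a))
    (h2 : HasSum (fun a => if P a then q ^ f a * A a else 0) S) :
    HasSum (fun x : α × β => if P x.1 ∧ Q x.1 x.2 then q ^ (f x.1 + g x.2) else 0) S := by
  -- Domination by the unconstrained product gives summability, so the iterated sum determines the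
  -- total.
  have hs : Summable fun x : α × β => if P x.1 ∧ Q x.1 x.2 then q ^ (f x.1 + g x.2) else 0 := by
    simp only [pow_add]
    exact summable_ite_of_summable (hf.hasSum.mul_prod hg.hasSum).summable _
  have hfib := hs.hasSum.prod_fiberwise (g := fun a => if P a then q ^ f a * A a else 0) fun a => ?_
  · rw [h2.unique hfib]
    exact hs.hasSum
  · by_cases ha : P a
    · rw [if_pos ha]
      refine ((h1 a ha).mul_left (q ^ f a)).of_eq fun b => ?_
      simp [ha, pow_add]
    · simp only [ha, false_and, if_false]
      exact hasSum_zero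

theorem prod_one_sub_pow_ne_zero {q : ℂ} (hq : ‖q‖ < 1) (m s : ℕ) :
    ∏ j ∈ Finset.range m, (1 - q ^ (j + (s + 1)))⁻¹ ≠ 0 :=
  Finset.prod_ne_zero_iff.mpr fun j _ => inv_ne_zero (one_sub_pow_ne_zero hq (j + s))

/-- For `μ = 0` the branching rule has the single term `l = 0`. The resulting recursion normalises
the alternants and shows that the denominator does not vanish. -/
theorem qAlternant_zero_succ {q : ℂ} (hq : ‖q‖ < 1) (m : ℕ) :
    qAlternant q (0 : Fin (m + 1) → ℕ) * ∏ j ∈ Finset.range m, (1 - q ^ (j + 1))⁻¹ =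
      q ^ m.choose 2 * qAlternant q (0 : Fin m → ℕ) := by
  refine (hasSum_qAlternant_succ hq (0 : Fin (m + 1) → ℕ) antitone_const).unique ?_
  refine (hasSum_ite_eq (0 : Fin m → ℕ) (q ^ m.choose 2 * qAlternant q (0 : Fin m → ℕ))).of_eq
    fun l => ?_
  have : (∀ i : Fin m, (0 : Fin (m + 1) → ℕ) i.succ ≤ l i ∧
      l i ≤ (0 : Fin (m + 1) → ℕ) i.castSucc) ↔ l = 0 := by
    simp [funext_iff]
  simp only [this]
  split_ifs with h
  · subst h
    simp
  · rfl

theorem qAlternant_zero_ne_zero {q : ℂ} (hq0 : q ≠ 0) (hq : ‖q‖ < 1) (m : ℕ) :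
    qAlternant q (0 : Fin m → ℕ) ≠ 0 := by
  induction m with
  | zero => simp [qAlternant]
  | succ m ih =>
    intro h
    have := qAlternant_zero_succ hq m
    rw [h, zero_mul] at this
    exact mul_ne_zero (pow_ne_zero _ hq0) ih this.symm

open scoped Classical in
/-- Branching rule: triangular arrays with prescribed last diagonal. -/
theorem TriArray.hasSum_interlaces {q : ℂ} (hq0 : q ≠ 0) (hq : ‖q‖ < 1) (m : ℕ) (μ : Fin m → ℕ)
    (hμ : Antitone μ) :
    HasSum (fun x : TriArray m => if Interlaces m μ x then q ^ weight m x else 0)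
      (qAlternant q μ / qAlternant q (0 : Fin m → ℕ)) := by
  induction m with
  | zero =>
    let _ : Unique (TriArray 0) := inferInstanceAs (Unique Unit)
    simp [qAlternant, Interlaces, weight]
  | succ m ih =>
    refine HasSum.of_eq (hasSum_prod_of_fiber (α := Fin m → ℕ) (β := TriArray m)
      (f := fun l => ∑ i, l i) (g := weight m) (q := q)
      (P := fun l => ∀ i, μ i.succ ≤ l i ∧ l i ≤ μ i.castSucc) (Q := Interlaces m)
      (A := fun l => qAlternant q l / qAlternant q (0 : Fin m → ℕ))
      (hasSum_pow_sum (ι := Fin m) hq).summable (summable_pow_weight hq m) (fun l hl => ?_) ?_)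
      fun x => if_congr Iff.rfl rfl rfl
    -- A sequence interlacing with `μ` is itself weakly decreasing, since `l j ≤ μ j ≤ μ (i + 1) ≤ l
    -- i` for `i < j`.
    · refine ih l fun i j hij => ?_
      rcases hij.eq_or_lt with rfl | hij
      · rfl
      · exact (hl j).2.trans ((hμ (by simpa [Fin.le_def] using hij)).trans (hl i).1)
    · have hP := prod_one_sub_pow_ne_zero hq m 0
      have h0 := qAlternant_zero_ne_zero hq0 hq m
      have hc := pow_ne_zero (m.choose 2) hq0
      have hz := qAlternant_zero_succ hq m
      have h := (hasSum_qAlternant_succ hq μ hμ).mul_left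
        (q ^ m.choose 2 * qAlternant q (0 : Fin m → ℕ))⁻¹
      have e : qAlternant q μ / qAlternant q (0 : Fin (m + 1) → ℕ) =
          (q ^ m.choose 2 * qAlternant q (0 : Fin m → ℕ))⁻¹ *
            (qAlternant q μ * ∏ j ∈ Finset.range m, (1 - q ^ (j + 1))⁻¹) := by
        rw [← hz]
        have h1 := qAlternant_zero_ne_zero hq0 hq (m + 1)
        rw [mul_comm (qAlternant q μ), ← div_eq_inv_mul, mul_comm (qAlternant q 0),
          mul_div_mul_left _ _ hP]
      rw [e]
      refine h.of_eq fun l => ?_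
      split_ifs
      · field_simp
      · simp

open scoped Classical in
/-- Arrays with prescribed last diagonal. -/
theorem DiagArray.hasSum_interlaces {q : ℂ} (hq0 : q ≠ 0) (hq : ‖q‖ < 1) (m s : ℕ)
    (μ : Fin (m + 1) → ℕ) (hμ : Antitone μ) :
    HasSum (fun x : DiagArray m s => if Interlaces m s μ x then q ^ weight m s x else 0)
      ((∏ t ∈ Finset.range s, ∏ j ∈ Finset.range (m + 1), (1 - q ^ (j + (t + 1)))⁻¹) *
        (q ^ (s * ∑ i, μ i) * (qAlternant q μ / qAlternant q (0 : Fin (m + 1) → ℕ)))) := by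
  induction s generalizing μ with
  | zero =>
    have h := TriArray.hasSum_interlaces hq0 hq (m + 1) μ hμ
    simp only [Finset.range_zero, Finset.prod_empty, zero_mul, pow_zero, one_mul]
    exact h
  | succ s ih =>
    set K := ∏ t ∈ Finset.range s, ∏ j ∈ Finset.range (m + 1), (1 - q ^ (j + (t + 1)))⁻¹
    refine HasSum.of_eq (hasSum_prod_of_fiber (α := Fin (m + 1) → ℕ) (β := DiagArray m s)
      (f := fun l => ∑ i, l i) (g := weight m s) (q := q)
      (P := fun l => (∀ i, μ i ≤ l i) ∧ ∀ i : Fin m, l i.succ ≤ μ i.castSucc)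
      (Q := Interlaces m s)
      (A := fun l => K * (q ^ (s * ∑ i, l i) *
        (qAlternant q l / qAlternant q (0 : Fin (m + 1) → ℕ))))
      (hasSum_pow_sum (ι := Fin (m + 1)) hq).summable (summable_pow_weight hq m s)
      (fun l hl => ih l (Fin.antitone_iff_succ_le.mpr fun i => (hl.2 i).trans (hl.1 _))) ?_)
      fun x => if_congr Iff.rfl rfl rfl
    have hc := pow_ne_zero ((s + 1) * (m + 1).choose 2) hq0
    have h := (hasSum_qAlternant_horizontalStrip hq s μ hμ).mul_left
      (K * (q ^ ((s + 1) * (m + 1).choose 2) * qAlternant q (0 : Fin (m + 1) → ℕ))⁻¹)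
    rw [show (K * (q ^ ((s + 1) * (m + 1).choose 2) * qAlternant q (0 : Fin (m + 1) → ℕ))⁻¹) *
        (q ^ ((s + 1) * (m + 1).choose 2) * (q ^ ((s + 1) * ∑ i, μ i) * qAlternant q μ) *
          ∏ j ∈ Finset.range (m + 1), (1 - q ^ (j + (s + 1)))⁻¹) =
        (K * ∏ j ∈ Finset.range (m + 1), (1 - q ^ (j + (s + 1)))⁻¹) * (q ^ ((s + 1) * ∑ i, μ i) *
          (qAlternant q μ / qAlternant q (0 : Fin (m + 1) → ℕ))) by field_simp,
      ← Finset.prod_range_succ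
        (fun t => ∏ j ∈ Finset.range (m + 1), (1 - q ^ (j + (t + 1)))⁻¹)] at h
    refine h.of_eq fun l => ?_
    split_ifs
    · rw [add_mul s 1 (∑ i, l i), one_mul, pow_add]
      field_simp
    · simp

/-! ### Passing between fillings of the quadrant and their diagonals -/

namespace TriArray

theorem interlaces_ofFun : ∀ (m : ℕ) (F : ℕ → ℕ → ℕ), (∀ i j, F i (j + 1) ≤ F i j) →
    (∀ i j, F (i + 1) j ≤ F i j) → Interlaces m (fun i => F i i) (ofFun m F)
  | 0, _, _, _ => trivial
  | m + 1, F, hr, hc => ⟨fun i => ⟨hr (i + 1) i, hc i i⟩,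
      interlaces_ofFun m (fun i j => F (i + 1) j) (fun i j => hr (i + 1) j) fun i j => hc (i + 1) j⟩

theorem weight_ofFun : ∀ (m : ℕ) (F : ℕ → ℕ → ℕ),
    weight m (ofFun m F) = ∑ i ∈ Finset.range m, ∑ j ∈ Finset.range i, F i j
  | 0, _ => rfl
  | m + 1, F => by
    rw [Finset.sum_range_succ']
    simp only [weight, ofFun, weight_ofFun m, Finset.sum_range_succ, Finset.sum_add_distrib,
      Finset.range_zero, Finset.sum_empty, add_zero]
    rw [add_comm, Fin.sum_univ_eq_sum_range (fun i => F (i + 1) i)]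

theorem eq_of_ofFun_eq : ∀ (m : ℕ) (F G : ℕ → ℕ → ℕ), ofFun m F = ofFun m G →
    ∀ i < m, ∀ j < i, F i j = G i j
  | 0, _, _, _, i, hi, _, _ => absurd hi (Nat.not_lt_zero i)
  | m + 1, F, G, h, i, hi, j, hj => by
    obtain ⟨h1, h2⟩ := Prod.mk.inj h
    obtain ⟨i, rfl⟩ : ∃ i', i = i' + 1 := ⟨i - 1, by omega⟩
    rcases (Nat.lt_succ_iff.mp hj).eq_or_lt with rfl | hj'
    · exact congrFun h1 ⟨j, by omega⟩
    · exact eq_of_ofFun_eq m _ _ h2 i (by omega) j hj'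

theorem ofFun_congr : ∀ (m : ℕ) (F G : ℕ → ℕ → ℕ), (∀ i < m, ∀ j < i, F i j = G i j) →
    ofFun m F = ofFun m G
  | 0, _, _, _ => rfl
  | m + 1, F, G, h => Prod.ext (funext fun i => h (i + 1) (by omega) i (by omega))
      (ofFun_congr m _ _ fun i hi j hj => h (i + 1) (by omega) j (by omega))

/-- Monotonicity is asserted only on the triangle with its boundary diagonal; the values of `F`
elsewhere are arbitrary. -/
theorem exists_ofFun_eq : ∀ (m : ℕ) (μ : Fin m → ℕ) (x : TriArray m), Interlaces m μ x →
    ∃ F : ℕ → ℕ → ℕ, (∀ i < m, ∀ j < i, F i (j + 1) ≤ F i j) ∧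
      (∀ i, i + 1 < m → ∀ j ≤ i, F (i + 1) j ≤ F i j) ∧ (∀ i : Fin m, F i i = μ i) ∧
      ofFun m F = x
  | 0, _, _, _ => ⟨fun _ _ => 0, by simp, by simp, fun i => i.elim0, rfl⟩
  | m + 1, μ, x, ⟨hx, hx'⟩ => by
    obtain ⟨F, hr, hc, hd, hF⟩ := exists_ofFun_eq m x.1 x.2 hx'
    have hd' : ∀ i (hi : i < m), F i i = x.1 ⟨i, hi⟩ := fun i hi => hd ⟨i, hi⟩
    -- The smaller triangle moves down one row and `μ` fills the new main diagonal.
    refine ⟨fun i j => if j = i then (if h : i < m + 1 then μ ⟨i, h⟩ else 0) else F (i - 1) j,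
      fun i hi j hj => ?_, fun i hi j hj => ?_, fun i => ?_, ?_⟩
    · obtain ⟨i, rfl⟩ : ∃ i', i = i' + 1 := ⟨i - 1, by omega⟩
      dsimp only
      rw [if_neg hj.ne, Nat.add_sub_cancel, dif_pos hi]
      split_ifs with h
      · obtain rfl : j = i := by omega
        rw [hd' j (by omega)]
        exact (hx ⟨j, by omega⟩).1
      · exact hr i (by omega) j (by omega)
    · dsimp only
      rw [if_neg (by omega), Nat.add_sub_cancel]
      split_ifs with h h'
      · subst h
        rw [hd' j (by omega)]
        exact (hx ⟨j, by omega⟩).2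
      · omega
      · obtain ⟨i, rfl⟩ : ∃ i', i = i' + 1 := ⟨i - 1, by omega⟩
        exact hc i (by omega) j (by omega)
    · simp only [i.isLt, dif_pos, ite_true, Fin.eta]
    · refine Prod.ext (funext fun i => ?_) ((ofFun_congr m _ _ fun i hi j hj => ?_).trans hF)
      · simp [ofFun, hd]
      · simp [show j ≠ i + 1 by omega]

end TriArray

namespace DiagArray

theorem interlaces_ofFun (m : ℕ) (F : ℕ → ℕ → ℕ) (hr : ∀ i j, F i (j + 1) ≤ F i j)
    (hc : ∀ i j, F (i + 1) j ≤ F i j) :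
    ∀ s : ℕ, Interlaces m s (fun i => F i (i + s)) (ofFun m s F)
  | 0 => TriArray.interlaces_ofFun (m + 1) F hr hc
  | s + 1 => ⟨⟨fun i => hr i (i + s), fun i => by
      have := hc i (i + (s + 1))
      simp only [ofFun, Fin.val_succ, Fin.val_castSucc]
      rwa [add_right_comm, add_assoc (i : ℕ)]⟩,
      interlaces_ofFun m F hr hc s⟩

theorem weight_ofFun (m : ℕ) (F : ℕ → ℕ → ℕ) : ∀ s : ℕ, weight m s (ofFun m s F) =
    ∑ i ∈ Finset.range (m + 1), ∑ j ∈ Finset.range (i + s), F i j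
  | 0 => TriArray.weight_ofFun (m + 1) F
  | s + 1 => by
    simp only [weight, ofFun, weight_ofFun m F s, ← add_assoc, Finset.sum_range_succ _ (_ + s),
      Finset.sum_add_distrib]
    rw [add_comm, Fin.sum_univ_eq_sum_range (fun i => F i (i + s))]

theorem eq_of_ofFun_eq (m : ℕ) (F G : ℕ → ℕ → ℕ) : ∀ s : ℕ, ofFun m s F = ofFun m s G →
    ∀ i < m + 1, ∀ j < i + s, F i j = G i j
  | 0, h, i, hi, j, hj => TriArray.eq_of_ofFun_eq (m + 1) F G h i hi j hj
  | s + 1, h, i, hi, j, hj => by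
    obtain ⟨h1, h2⟩ := Prod.mk.inj h
    rcases (Nat.lt_succ_iff.mp hj).eq_or_lt with rfl | hj'
    · exact congrFun h1 ⟨i, hi⟩
    · exact eq_of_ofFun_eq m F G s h2 i hi j hj'

theorem ofFun_congr (m : ℕ) (F G : ℕ → ℕ → ℕ) : ∀ s : ℕ,
    (∀ i < m + 1, ∀ j < i + s, F i j = G i j) → ofFun m s F = ofFun m s G
  | 0, h => TriArray.ofFun_congr (m + 1) F G h
  | s + 1, h => Prod.ext (funext fun i => h i (by omega) (i + s) (by omega))
      (ofFun_congr m F G s fun i hi j hj => h i hi j (by omega))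

theorem exists_ofFun_eq (m : ℕ) : ∀ (s : ℕ) (μ : Fin (m + 1) → ℕ) (x : DiagArray m s),
    Interlaces m s μ x →
    ∃ F : ℕ → ℕ → ℕ, (∀ i < m + 1, ∀ j < i + s, F i (j + 1) ≤ F i j) ∧
      (∀ i < m, ∀ j ≤ i + s, F (i + 1) j ≤ F i j) ∧ (∀ i : Fin (m + 1), F i (i + s) = μ i) ∧
      ofFun m s F = x
  | 0, μ, x, h => by
    obtain ⟨F, hr, hc, hd, hF⟩ := TriArray.exists_ofFun_eq (m + 1) μ x h
    exact ⟨F, hr, fun i hi => hc i (by omega), hd, hF⟩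
  | s + 1, μ, x, ⟨⟨hx, hx'⟩, hy⟩ => by
    obtain ⟨F, hr, hc, hd, hF⟩ := exists_ofFun_eq m s x.1 x.2 hy
    have hd' : ∀ i (hi : i < m + 1), F i (i + s) = x.1 ⟨i, hi⟩ := fun i hi => hd ⟨i, hi⟩
    refine ⟨fun i j => if j ≤ i + s then F i j else if h : i < m + 1 then μ ⟨i, h⟩ else 0,
      fun i hi j hj => ?_, fun i hi j hj => ?_, fun i => ?_, ?_⟩
    · dsimp only
      rw [if_pos (show j ≤ i + s by omega), dif_pos hi]
      split_ifs with h
      · exact hr i hi j (by omega)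
      · obtain rfl : j = i + s := by omega
        rw [hd' i hi]
        exact hx _
    · dsimp only
      rw [if_pos (show j ≤ i + 1 + s by omega), dif_pos (show i < m + 1 by omega)]
      split_ifs with h
      · exact hc i hi j h
      · obtain rfl : j = i + 1 + s := by omega
        rw [hd' (i + 1) (by omega)]
        exact hx' ⟨i, hi⟩
    · simp only [i.isLt, dif_pos, Fin.eta]
      rw [if_neg (by omega)]
    · refine Prod.ext (funext fun i => ?_) ((ofFun_congr m _ _ s fun i hi j hj => ?_).trans hF)
      · simp [ofFun, hd]
      · simp [show j ≤ i + s by omega]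

end DiagArray

/-! ### The truncated rectangle and its completion by diagonals -/

theorem mem_almostSquareDiagram {m s k : ℕ} (hk : 1 ≤ k) (i j : ℕ) :
    (i, j) ∈ almostSquareDiagram m (s + k) k ↔
      i < m ∧ j < if i + 1 < k then s else if i + 1 = k then s + 1 else s + k := by
  rw [almostSquareDiagram, mem_truncatedDiagram]
  simp only [List.getD_eq_getElem?_getD, List.getElem?_replicate, List.getElem?_append,
    List.length_replicate]
  by_cases h1 : i < m
  · rcases lt_trichotomy (i + 1) k with h2 | h2 | h2
    · simp [h1, h2, show i < k - 1 by omega]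
    · simp [h1, h2, show ¬ i < k - 1 by omega, show i - (k - 1) = 0 by omega]
      omega
    · have : (([k - 1] : List ℕ)[i - (k - 1)]?) = none := by simp; omega
      simp [h1, show ¬ i + 1 < k by omega, show ¬ i + 1 = k by omega, show ¬ i < k - 1 by omega, this]
  · simp [h1]

theorem sum_almostSquareDiagram {m s k : ℕ} (hk : 1 ≤ k) (F : ℕ → ℕ → ℕ) :
    ∑ x ∈ almostSquareDiagram m (s + k) k, F x.1 x.2 = ∑ i ∈ Finset.range m,
      ∑ j ∈ Finset.range (if i + 1 < k then s else if i + 1 = k then s + 1 else s + k), F i j :=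
  Finset.sum_finset_product' _ _ _ fun p => by
    rw [← Prod.mk.eta (p := p), mem_almostSquareDiagram hk]
    simp

theorem card_almostSquareDiagram {m s k : ℕ} (hk : 1 ≤ k) (hkm : k ≤ m) :
    (almostSquareDiagram m (s + k) k).card = m * s + k * (m - k) + 1 := by
  have h := sum_almostSquareDiagram (m := m) (s := s) hk fun _ _ => 1
  rw [← Finset.card_eq_sum_ones] at h
  rw [h]
  obtain ⟨p, rfl⟩ := Nat.exists_eq_add_of_le hkm
  obtain ⟨k, rfl⟩ := Nat.exists_eq_add_of_le' hk
  simp only [Finset.sum_const, Finset.card_range, smul_eq_mul, mul_one]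
  rw [Finset.sum_range_add, Finset.sum_range_succ, Finset.sum_congr rfl (g := fun _ => s),
    Finset.sum_congr (s₁ := Finset.range p) rfl (g := fun _ => s + (k + 1))]
  · simp
    ring
  · intro i hi
    rw [if_neg (by omega), if_neg (by omega)]
  · intro i hi
    rw [if_pos (by simpa using hi)]

theorem mem_almostSquareDiagram_iff {m s k : ℕ} (hk : 1 ≤ k) (hkm : k ≤ m) (i j : ℕ) :
    (i, j) ∈ almostSquareDiagram m (s + k) k ↔
      (i + 1 < k ∧ j < s) ∨ (i + 1 = k ∧ j ≤ s) ∨ (k ≤ i ∧ i < m ∧ j < s + k) := by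
  rw [mem_almostSquareDiagram hk]
  split_ifs <;> omega

theorem pivot_mem {m s k : ℕ} (hk : 1 ≤ k) (hkm : k ≤ m) :
    (k - 1, s) ∈ almostSquareDiagram m (s + k) k := by
  rw [mem_almostSquareDiagram_iff hk hkm]
  omega

theorem IsPlanePartition.le_of_le {m s k : ℕ} (hk : 1 ≤ k) (hkm : k ≤ m)
    {T : almostSquareDiagram m (s + k) k → ℕ} (hT : IsPlanePartition _ T) {i j i' j' : ℕ}
    (h : (i, j) ∈ almostSquareDiagram m (s + k) k)
    (h' : (i', j') ∈ almostSquareDiagram m (s + k) k) (hi : i ≤ i') (hj : j ≤ j') :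
    T ⟨(i', j'), h'⟩ ≤ T ⟨(i, j), h⟩ := by
  -- Row lengths weakly increase downwards, so the lower left corner of the path stays in the
  -- diagram; `(i, j')` may lie in the removed part.
  have hm : (i', j) ∈ almostSquareDiagram m (s + k) k := by
    rw [mem_almostSquareDiagram_iff hk hkm] at h' ⊢
    omega
  refine le_trans (b := T ⟨(i', j), hm⟩) ?_ ?_
  · rcases hj.eq_or_lt with rfl | hj
    · rfl
    · exact hT.1 ⟨(i', j), hm⟩ ⟨(i', j'), h'⟩ rfl hj
  · rcases hi.eq_or_lt with rfl | hi
    · rfl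
    · exact hT.2 ⟨(i, j), h⟩ ⟨(i', j), hm⟩ rfl hi

/-- Extend a filling of a diagram by `c` in the first `k` rows and by `0` below. -/
noncomputable def extendFilling {D : Finset (ℕ × ℕ)} (k c : ℕ) (T : D → ℕ) (i j : ℕ) : ℕ :=
  if h : (i, j) ∈ D then T ⟨(i, j), h⟩ else if i < k then c else 0

theorem extendFilling_row {m s k : ℕ} (hk : 1 ≤ k) (hkm : k ≤ m)
    {T : almostSquareDiagram m (s + k) k → ℕ} (hT : IsPlanePartition _ T) (i j : ℕ) :
    extendFilling k (T ⟨_, pivot_mem hk hkm⟩) T i (j + 1) ≤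
      extendFilling k (T ⟨_, pivot_mem hk hkm⟩) T i j := by
  have h1 := mem_almostSquareDiagram_iff (s := s) hk hkm i j
  have h2 := mem_almostSquareDiagram_iff (s := s) hk hkm i (j + 1)
  unfold extendFilling
  split_ifs with ha hb hc hb
  · exact hT.le_of_le hk hkm _ _ le_rfl (Nat.le_succ j)
  · grind
  · grind
  · exact hT.le_of_le hk hkm _ _ (by grind) (by grind)
  · exact le_rfl
  · exact Nat.zero_le _
  · exact le_rfl

theorem extendFilling_col {m s k : ℕ} (hk : 1 ≤ k) (hkm : k ≤ m)
    {T : almostSquareDiagram m (s + k) k → ℕ} (hT : IsPlanePartition _ T) (i j : ℕ) :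
    extendFilling k (T ⟨_, pivot_mem hk hkm⟩) T (i + 1) j ≤
      extendFilling k (T ⟨_, pivot_mem hk hkm⟩) T i j := by
  have h1 := mem_almostSquareDiagram_iff (s := s) hk hkm i j
  have h2 := mem_almostSquareDiagram_iff (s := s) hk hkm (i + 1) j
  unfold extendFilling
  split_ifs with ha hb hc hb hc hd
  · exact hT.le_of_le hk hkm _ _ (Nat.le_succ i) le_rfl
  · exact hT.le_of_le hk hkm _ _ (by grind) (by grind)
  · grind
  · exact hT.le_of_le hk hkm _ _ (by grind) (by grind)
  · exact le_rfl
  · omega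
  · exact Nat.zero_le _
  · exact Nat.zero_le _
  · exact le_rfl

theorem extendFilling_of_lt {m s k : ℕ} (hk : 1 ≤ k) (hkm : k ≤ m)
    (T : almostSquareDiagram m (s + k) k → ℕ) {i j : ℕ} (hi : i < k) (hj : s ≤ j) :
    extendFilling k (T ⟨_, pivot_mem hk hkm⟩) T i j = T ⟨_, pivot_mem hk hkm⟩ := by
  have h1 := mem_almostSquareDiagram_iff (s := s) hk hkm i j
  unfold extendFilling
  split_ifs with ha
  · obtain ⟨rfl, rfl⟩ : i = k - 1 ∧ j = s := by grind
    rfl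
  · rfl

theorem extendFilling_of_ge {m s k : ℕ} (hk : 1 ≤ k) (hkm : k ≤ m)
    (T : almostSquareDiagram m (s + k) k → ℕ) (c : ℕ) {i j : ℕ} (hi : k ≤ i) (hj : s + k ≤ j) :
    extendFilling k c T i j = 0 := by
  have h1 := mem_almostSquareDiagram_iff (s := s) hk hkm i j
  unfold extendFilling
  rw [dif_neg (by grind), if_neg (by omega)]

/-- Left of the diagonal `j = i + s`, row `i < k` has `i` entries `c` from column `s` on, hence
`k.choose 2` in all, whereas the diagram has only the pivot there. -/
theorem sum_extend_eq {m s k c : ℕ} (hk : 1 ≤ k) (hkm : k ≤ m) (F : ℕ → ℕ → ℕ)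
    (h1 : ∀ i < k, ∀ j, s ≤ j → F i j = c) (h2 : ∀ i, k ≤ i → ∀ j, s + k ≤ j → F i j = 0) :
    ∑ i ∈ Finset.range m, ∑ j ∈ Finset.range (i + s), F i j + c =
      ∑ x ∈ almostSquareDiagram m (s + k) k, F x.1 x.2 + c * k.choose 2 := by
  rw [sum_almostSquareDiagram hk]
  obtain ⟨p, rfl⟩ := Nat.exists_eq_add_of_le hkm
  have e1 : ∀ i ∈ Finset.range k, ∑ j ∈ Finset.range (i + s), F i j =
      ∑ j ∈ Finset.range s, F i j + i * c := by
    intro i hi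
    rw [add_comm, Finset.sum_range_add, Finset.sum_congr (s₁ := Finset.range i) rfl
      (g := fun _ => c) fun j _ => h1 i (by simpa using hi) _ (by omega)]
    simp
  have e2 : ∀ i ∈ Finset.range p, ∑ j ∈ Finset.range (k + i + s), F (k + i) j =
      ∑ j ∈ Finset.range (s + k), F (k + i) j := by
    intro i _
    rw [show k + i + s = s + k + i by ring, Finset.sum_range_add _ (s + k),
      Finset.sum_eq_zero (s := Finset.range i), add_zero]
    exact fun j _ => h2 _ (by omega) _ (by omega)
  have e3 : ∀ i ∈ Finset.range p, ∑ j ∈ Finset.range (if k + i + 1 < k then s else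
      if k + i + 1 = k then s + 1 else s + k), F (k + i) j =
      ∑ j ∈ Finset.range (s + k), F (k + i) j := by
    intro i _
    rw [if_neg (by omega), if_neg (by omega)]
  have e4 : ∑ i ∈ Finset.range k, ∑ j ∈ Finset.range (if i + 1 < k then s else
      if i + 1 = k then s + 1 else s + k), F i j =
      ∑ i ∈ Finset.range k, ∑ j ∈ Finset.range s, F i j + c := by
    obtain ⟨k, rfl⟩ := Nat.exists_eq_add_of_le' hk
    rw [Finset.sum_range_succ, Finset.sum_range_succ, if_neg (by omega), if_pos rfl,
      Finset.sum_range_succ, h1 k (by omega) s le_rfl, add_assoc]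
    congr 1
    refine Finset.sum_congr rfl fun i hi => ?_
    rw [if_pos (by simpa using hi)]
  rw [Finset.sum_range_add, Finset.sum_range_add, Finset.sum_congr rfl e1, Finset.sum_congr rfl e2,
    Finset.sum_congr rfl e3, e4, Finset.sum_add_distrib, ← Finset.sum_mul, Finset.sum_range_id,
    Nat.choose_two_right]
  ring

section reconstruct

variable {m s : ℕ} {F : ℕ → ℕ → ℕ}

theorem row_antitone_of_step (hr : ∀ i < m + 1, ∀ j < i + s, F i (j + 1) ≤ F i j) {i j j' : ℕ}
    (hi : i < m + 1) (hj : j ≤ j') (hj' : j' ≤ i + s) : F i j' ≤ F i j := by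
  induction j', hj using Nat.le_induction with
  | base => rfl
  | succ j' _ ih => exact (hr i hi j' hj').trans (ih (by omega))

theorem col_antitone_of_step (hc : ∀ i < m, ∀ j ≤ i + s, F (i + 1) j ≤ F i j) {i i' j : ℕ}
    (hi : i ≤ i') (hi' : i' < m + 1) (hj : j ≤ i + s) : F i' j ≤ F i j := by
  induction i', hi using Nat.le_induction with
  | base => rfl
  | succ i' _ ih => exact (hc i' (by omega) j (by omega)).trans (ih (by omega))

end reconstruct

/-- The diagonal `c, …, c, 0, …, 0` with `k` entries `c`. -/
def constDiagonal (m k c : ℕ) (i : Fin (m + 1)) : ℕ :=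
  if (i : ℕ) < k then c else 0

theorem antitone_constDiagonal (m k c : ℕ) : Antitone (constDiagonal m k c) := by
  intro i j hij
  have : (i : ℕ) ≤ j := hij
  unfold constDiagonal
  split_ifs <;> omega

/-- The value at the pivot box together with the diagonals of the extended filling. -/
noncomputable def toDiagArray {m s k : ℕ} (hk : 1 ≤ k) (hkm : k ≤ m + 1)
    (T : {T : almostSquareDiagram (m + 1) (s + k) k → ℕ // IsPlanePartition _ T}) :
    ℕ × DiagArray m s :=
  (T.1 ⟨_, pivot_mem hk hkm⟩,
    DiagArray.ofFun m s (extendFilling k (T.1 ⟨_, pivot_mem hk hkm⟩) T.1))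

theorem toDiagArray_injective {m s k : ℕ} (hk : 1 ≤ k) (hkm : k ≤ m + 1) :
    Function.Injective (toDiagArray (s := s) hk hkm) := by
  intro T T' h
  obtain ⟨h1, h2⟩ := Prod.mk.inj h
  have h3 := DiagArray.eq_of_ofFun_eq m _ _ s h2
  refine Subtype.ext (funext fun ⟨⟨i, j⟩, hij⟩ => ?_)
  have hm := (mem_almostSquareDiagram_iff hk hkm i j).mp hij
  by_cases hlt : j < i + s
  · have := h3 i (by omega) j hlt
    simpa [extendFilling, hij] using this
  · obtain ⟨rfl, rfl⟩ : i = k - 1 ∧ j = s := by omega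
    exact h1

theorem interlaces_toDiagArray {m s k : ℕ} (hk : 1 ≤ k) (hkm : k ≤ m + 1)
    (T : {T : almostSquareDiagram (m + 1) (s + k) k → ℕ // IsPlanePartition _ T}) :
    DiagArray.Interlaces m s (constDiagonal m k (toDiagArray hk hkm T).1)
      (toDiagArray hk hkm T).2 := by
  have h := DiagArray.interlaces_ofFun m _ (extendFilling_row hk hkm T.2)
    (extendFilling_col hk hkm T.2) s
  have e : constDiagonal m k (toDiagArray hk hkm T).1 = fun i : Fin (m + 1) =>
      extendFilling k (T.1 ⟨_, pivot_mem hk hkm⟩) T.1 i (i + s) := by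
    funext i
    unfold constDiagonal
    split_ifs with hi
    · exact (extendFilling_of_lt hk hkm _ hi (by omega)).symm
    · exact (extendFilling_of_ge hk hkm _ _ (by omega) (by omega)).symm
  rw [e]
  exact h

theorem weight_toDiagArray {m s k : ℕ} (hk : 1 ≤ k) (hkm : k ≤ m + 1)
    (T : {T : almostSquareDiagram (m + 1) (s + k) k → ℕ // IsPlanePartition _ T}) :
    DiagArray.weight m s (toDiagArray hk hkm T).2 + (toDiagArray hk hkm T).1 =
      ∑ x, T.1 x + (toDiagArray hk hkm T).1 * k.choose 2 := by
  simp only [toDiagArray]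
  rw [DiagArray.weight_ofFun, sum_extend_eq hk hkm _
    (fun i hi j hj => extendFilling_of_lt hk hkm _ hi hj)
    (fun i hi j hj => extendFilling_of_ge hk hkm _ _ hi hj), ← Finset.sum_coe_sort]
  congr 1
  refine Finset.sum_congr rfl fun x _ => ?_
  rw [extendFilling, dif_pos x.2]

theorem exists_toDiagArray_eq {m s k : ℕ} (hk : 1 ≤ k) (hkm : k ≤ m + 1) (c : ℕ)
    (x : DiagArray m s) (hx : DiagArray.Interlaces m s (constDiagonal m k c) x) :
    ∃ T, toDiagArray hk hkm T = (c, x) := by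
  obtain ⟨F, hr, hc, hd, hF⟩ := DiagArray.exists_ofFun_eq m s _ x hx
  have hd' : ∀ i < m + 1, F i (i + s) = if i < k then c else 0 := fun i hi => hd ⟨i, hi⟩
  -- Squeezed between two diagonal entries equal to `c`: the end of row `i` and the top `(j - s, j)`
  -- of column `j`.
  have hlt : ∀ i < k, ∀ j, s ≤ j → j ≤ i + s → F i j = c := by
    intro i hi j hj hj'
    have h1 := row_antitone_of_step hr (by omega : i < m + 1) hj' le_rfl
    have h2 := col_antitone_of_step hc (by omega : j - s ≤ i) (by omega) (by omega : j ≤ j - s + s)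
    have h3 := hd' (j - s) (by omega)
    rw [hd' i (by omega), if_pos hi] at h1
    rw [Nat.sub_add_cancel hj, if_pos (by omega)] at h3
    omega
  have hge : ∀ i, k ≤ i → i < m + 1 → ∀ j, s + k ≤ j → j ≤ i + s → F i j = 0 := by
    intro i hi him j hj hj'
    have h2 := col_antitone_of_step hc (by omega : j - s ≤ i) him (by omega : j ≤ j - s + s)
    have h3 := hd' (j - s) (by omega)
    rw [Nat.sub_add_cancel (by omega), if_neg (by omega)] at h3
    omega
  have hpiv : F (k - 1) s = c := hlt (k - 1) (by omega) s le_rfl (by omega)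
  have hT : IsPlanePartition (almostSquareDiagram (m + 1) (s + k) k) fun x => F x.1.1 x.1.2 := by
    constructor
    · rintro ⟨⟨i, j⟩, ha⟩ ⟨⟨i', j'⟩, hb⟩ (rfl : i = i') (hj : j < j')
      rw [mem_almostSquareDiagram_iff hk hkm] at ha hb
      change F i j' ≤ F i j
      exact row_antitone_of_step hr (by omega) hj.le (by omega)
    · rintro ⟨⟨i, j⟩, ha⟩ ⟨⟨i', j'⟩, hb⟩ (rfl : j = j') (hi : i < i')
      rw [mem_almostSquareDiagram_iff hk hkm] at ha hb
      change F i' j ≤ F i j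
      exact col_antitone_of_step hc hi.le (by omega) (by omega)
  refine ⟨⟨_, hT⟩, Prod.ext hpiv ((DiagArray.ofFun_congr m _ _ s fun i hi j hj => ?_).trans hF)⟩
  have hm := mem_almostSquareDiagram_iff (s := s) hk hkm i j
  unfold extendFilling
  split_ifs with h1 h2
  · rfl
  · exact hpiv.trans (hlt i h2 j (by grind) hj.le).symm
  · exact (hge i (by omega) hi j (by grind) hj.le).symm

/-! ### Evaluation of the alternant ratio and of the generating function -/

theorem pow_sub_pow_ne_zero {q : ℂ} (hq0 : q ≠ 0) (hq : ‖q‖ < 1) {a b : ℕ} (hab : a ≠ b) :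
    q ^ a - q ^ b ≠ 0 := by
  intro h
  have h1 := congrArg norm (sub_eq_zero.mp h)
  rw [norm_pow, norm_pow] at h1
  exact hab (pow_right_injective₀ (norm_pos_iff.mpr hq0) hq.ne h1)

theorem det_vandermonde_range (v : ℕ → ℂ) (m : ℕ) :
    (Matrix.vandermonde fun i : Fin m => v i).det =
      ∏ i ∈ Finset.range m, ∏ j ∈ Finset.range m, if i < j then v j - v i else 1 := by
  rw [Matrix.det_vandermonde, ← Fin.prod_univ_eq_prod_range
    (fun i => ∏ j ∈ Finset.range m, if i < j then v j - v i else 1)]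
  refine Finset.prod_congr rfl fun i _ => ?_
  rw [← Fin.prod_univ_eq_prod_range (fun j => if (i : ℕ) < j then v j - v i else 1),
    ← Finset.prod_filter]
  refine Finset.prod_congr ?_ fun _ _ => rfl
  ext j
  simp

theorem eval_almostSquarePoly (m k : ℕ) (q v : ℂ) :
    (almostSquarePoly m k q).eval v = v ^ k.choose 2 *
      ∏ i ∈ Finset.Icc 1 k, ∏ j ∈ Finset.Icc (k + 1) m, (v * q ^ (m - i) - q ^ (m - j)) := by
  simp [almostSquarePoly, Polynomial.eval_prod]

theorem prod_reverse_Icc {M : Type*} [CommMonoid M] (f : ℕ → M) {a b m : ℕ} (hb : b ≤ m) :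
    ∏ i ∈ Finset.Ico a b, f (m - 1 - i) = ∏ i ∈ Finset.Ico (m - b) (m - a), f i := by
  refine Finset.prod_nbij' (fun i => m - 1 - i) (fun i => m - 1 - i) ?_ ?_ ?_ ?_ fun _ _ => rfl <;>
  · intro i hi
    simp only [Finset.mem_Ico] at hi ⊢
    omega

theorem prod_Icc_one_add {M : Type*} [CommMonoid M] (f : ℕ → M) (a b : ℕ) :
    ∏ i ∈ Finset.Icc (a + 1) b, f i = ∏ i ∈ Finset.Ico a b, f (i + 1) := by
  rw [Finset.prod_Ico_add' f a b 1]
  rfl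

/-- Compare the two Vandermonde products pair by pair: a pair inside the first `k` indices
contributes `q ^ c`, a pair outside contributes `1`, and a mixed pair contributes a factor of
$f_q(q^c)$ over its value at `c = 0`. -/
theorem qAlternant_constDiagonal_div {q : ℂ} (hq0 : q ≠ 0) (hq : ‖q‖ < 1) {m k : ℕ}
    (hkm : k ≤ m + 1) (c : ℕ) :
    qAlternant q (constDiagonal m k c) / qAlternant q (0 : Fin (m + 1) → ℕ) =
      (almostSquarePoly (m + 1) k q).eval (q ^ c) *
        ∏ i ∈ Finset.Ico (m + 1 - k) (m + 1), ∏ j ∈ Finset.range (m + 1 - k),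
          1 / (q ^ i - q ^ j) := by
  have hv := det_vandermonde_range (fun i => q ^ ((if i < k then c else 0) + (m - i))) (m + 1)
  have hw := det_vandermonde_range (fun i => q ^ (m - i)) (m + 1)
  have hterm : ∀ i ∈ Finset.range (m + 1), ∀ j ∈ Finset.range (m + 1),
      ((if i < j then q ^ ((if j < k then c else 0) + (m - j)) -
          q ^ ((if i < k then c else 0) + (m - i)) else 1) /
        if i < j then q ^ (m - j) - q ^ (m - i) else 1) =
      (if i < j then if j < k then q ^ c else 1 else 1) *
        (if i < k then if k ≤ j then (q ^ c * q ^ (m - i) - q ^ (m - j)) *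
          (1 / (q ^ (m - i) - q ^ (m - j))) else 1 else 1) := by
    intro i hi j hj
    rw [Finset.mem_range] at hi hj
    by_cases hij : i < j
    · have hne := pow_sub_pow_ne_zero hq0 hq (show m - j ≠ m - i by omega)
      have hne' := pow_sub_pow_ne_zero hq0 hq (show m - i ≠ m - j by omega)
      by_cases hjk : j < k
      · have hik : i < k := by omega
        simp only [hij, hjk, hik, if_true, if_neg (not_le.mpr hjk), pow_add]
        field_simp
      · by_cases hik : i < k
        · simp only [hij, hjk, hik, if_true, if_false, if_pos (not_lt.mp hjk), pow_add, pow_zero]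
          field_simp
          ring
        · simp only [hij, hjk, hik, if_true, if_false, zero_add, mul_one]
          exact div_self hne
    · simp only [hij, if_false, div_one, one_mul]
      by_cases hik : i < k
      · rw [if_pos hik, if_neg (by omega)]
      · rw [if_neg hik]
  have hv' : qAlternant q (constDiagonal m k c) = (Matrix.vandermonde fun i : Fin (m + 1) =>
      q ^ ((if (i : ℕ) < k then c else 0) + (m - i))).det := by
    simp [qAlternant, constDiagonal, Fin.val_rev]
  have hw' : qAlternant q (0 : Fin (m + 1) → ℕ) =
      (Matrix.vandermonde fun i : Fin (m + 1) => q ^ (m - i)).det := by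
    simp [qAlternant, Fin.val_rev]
  rw [hv', hw', hv, hw]
  simp only [← Finset.prod_div_distrib]
  rw [Finset.prod_congr rfl fun i hi => Finset.prod_congr rfl (hterm i hi)]
  simp only [Finset.prod_mul_distrib]
  rw [eval_almostSquarePoly, mul_assoc]
  congr 1
  · rw [Finset.prod_comm]
    have e : ∀ j ∈ Finset.range (m + 1), (∏ i ∈ Finset.range (m + 1),
        if i < j then if j < k then q ^ c else 1 else 1) = if j < k then (q ^ c) ^ j else 1 := by
      intro j hj
      rw [Finset.mem_range] at hj
      rw [← Finset.prod_filter, show (Finset.range (m + 1)).filter (· < j) = Finset.range j by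
        ext; simp; omega]
      split_ifs <;> simp
    rw [Finset.prod_congr rfl e, ← Finset.prod_filter,
      show (Finset.range (m + 1)).filter (· < k) = Finset.range k by ext; simp; omega,
      Finset.prod_pow_eq_pow_sum, Finset.sum_range_id, Nat.choose_two_right]
  · have e : ∀ i ∈ Finset.range (m + 1), ∀ f : ℕ → ℂ,
        (∏ j ∈ Finset.range (m + 1), if i < k then if k ≤ j then f j else 1 else 1) =
          if i < k then ∏ j ∈ Finset.Ico k (m + 1), f j else 1 := by
      intro i _ f
      split_ifs
      · rw [← Finset.prod_filter]
        refine Finset.prod_congr ?_ fun _ _ => rfl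
        ext; simp; omega
      · simp
    rw [Finset.prod_congr rfl fun i hi => e i hi _, ← Finset.prod_filter,
      show (Finset.range (m + 1)).filter (· < k) = Finset.Ico 0 k by ext; simp; omega]
    simp only [Finset.prod_mul_distrib]
    congr 1
    · rw [prod_Icc_one_add _ 0]
      refine Finset.prod_congr rfl fun i _ => ?_
      rw [prod_Icc_one_add _ k]
      refine Finset.prod_congr rfl fun j _ => ?_
      rw [Nat.add_sub_add_right, Nat.add_sub_add_right]
    · have h1 := prod_reverse_Icc (fun i => ∏ j ∈ Finset.Ico k (m + 1),
        1 / (q ^ i - q ^ (m + 1 - 1 - j))) (a := 0) hkm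
      rw [Nat.add_sub_cancel, Nat.sub_zero] at h1
      rw [h1]
      refine Finset.prod_congr rfl fun i _ => ?_
      have h2 := prod_reverse_Icc (fun j => 1 / (q ^ i - q ^ j)) (a := k) (le_refl (m + 1))
      rw [Nat.add_sub_cancel, Nat.sub_self, ← Finset.range_eq_Ico] at h2
      exact h2

/-- Summing the polynomial over its values at the powers of `q`. -/
theorem hasSum_eval_almostSquarePoly {q : ℂ} (hq0 : q ≠ 0) (hq : ‖q‖ < 1) (m s k : ℕ) :
    HasSum (fun c : ℕ => q ^ c / q ^ (c * k.choose 2) * (q ^ (s * (k * c)) *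
        (almostSquarePoly m k q).eval (q ^ c)))
      (∑ r ∈ Finset.range ((almostSquarePoly m k q).natDegree + 1),
        (almostSquarePoly m k q).coeff r *
          (1 / (1 - q ^ ((r : ℤ) + k * (s + k : ℕ) - k ^ 2 - k.choose 2 + 1)))) := by
  simp only [Polynomial.eval_eq_sum_range, Finset.mul_sum]
  refine hasSum_sum fun r _ => ?_
  -- Below `k.choose 2` the coefficients vanish; from there on the ratio is a positive power of `q`,
  -- so the series in `c` converges.
  by_cases hr : r < k.choose 2
  · have h0 : (almostSquarePoly m k q).coeff r = 0 := by
      rw [almostSquarePoly, Polynomial.coeff_X_pow_mul', if_neg (by omega)]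
    simp [h0]
  · obtain ⟨t, rfl⟩ := Nat.exists_eq_add_of_le (not_lt.mp hr)
    have hexp : (((k.choose 2 + t : ℕ) : ℤ) + k * (s + k : ℕ) - k ^ 2 - k.choose 2 + 1) =
        ((t + k * s + 1 : ℕ) : ℤ) := by
      push_cast
      ring
    rw [hexp, zpow_natCast, one_div]
    refine ((hasSum_geometric_of_norm_lt_one
      (norm_pow_succ_lt_one hq (t + k * s))).mul_left _).of_eq fun c => ?_
    have : q ^ (c * k.choose 2) ≠ 0 := pow_ne_zero _ hq0
    field_simp
    ring

/-- The generating function of plane partitions of almost-square truncated rectangles. -/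
theorem hasSum_almostSquareGF {q : ℂ} (hq0 : q ≠ 0) (hq : ‖q‖ < 1) {m n k : ℕ} (hk : 1 ≤ k)
    (hkm : k ≤ m) (hkn : k ≤ n) :
    HasSum (fun T : {T : almostSquareDiagram m n k → ℕ //
        IsPlanePartition (almostSquareDiagram m n k) T} => q ^ (∑ c, T.1 c))
      (almostSquareGF m n k q) := by
  classical
  obtain ⟨s, rfl⟩ := Nat.exists_eq_add_of_le' hkn
  obtain ⟨m, rfl⟩ := Nat.exists_eq_add_of_le' (hk.trans hkm)
  set f : ℕ × DiagArray m s → ℂ := fun x => q ^ x.1 / q ^ (x.1 * k.choose 2) *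
    if DiagArray.Interlaces m s (constDiagonal m k x.1) x.2 then q ^ DiagArray.weight m s x.2 else 0
    with hf
  have hcomp : ∀ T, q ^ (∑ c, T.1 c) = (f ∘ toDiagArray (s := s) hk hkm) T := by
    intro T
    have hw := weight_toDiagArray hk hkm T
    have h0 : q ^ ((toDiagArray hk hkm T).1 * k.choose 2) ≠ 0 := pow_ne_zero _ hq0
    simp only [Function.comp_apply, hf, if_pos (interlaces_toDiagArray hk hkm T)]
    rw [div_mul_eq_mul_div, eq_div_iff h0, ← pow_add, ← pow_add, ← hw, add_comm]
  have hrange : ∀ x ∉ Set.range (toDiagArray (s := s) hk hkm), f x = 0 := by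
    rintro ⟨c, x⟩ hx
    simp only [hf]
    rw [if_neg, mul_zero]
    exact fun h => hx (exists_toDiagArray_eq hk hkm c x h)
  -- Off the image `f` vanishes, and on it `f` is a subfamily of the series over all fillings.
  have hsum : Summable f := by
    rw [← (toDiagArray_injective hk hkm).summable_iff hrange, ← funext hcomp]
    exact (hasSum_pow_sum hq).summable.comp_injective Subtype.val_injective
  have hfib := hsum.hasSum.prod_fiberwise fun c => (DiagArray.hasSum_interlaces hq0 hq m s
    (constDiagonal m k c) (antitone_constDiagonal m k c)).mul_left (q ^ c / q ^ (c * k.choose 2))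
  have hval : ∀ c, ∑ i, constDiagonal m k c i = k * c := by
    intro c
    simp only [constDiagonal]
    rw [Fin.sum_univ_eq_sum_range (fun i => if i < k then c else 0) (m + 1), ← Finset.sum_filter,
      show (Finset.range (m + 1)).filter (· < k) = Finset.range k by ext; simp; omega]
    simp
  have hGF : HasSum f (almostSquareGF (m + 1) (s + k) k q) := by
    have h := ((hasSum_eval_almostSquarePoly hq0 hq (m + 1) s k).mul_right
      (∏ i ∈ Finset.Ico (m + 1 - k) (m + 1), ∏ j ∈ Finset.range (m + 1 - k),
          1 / (q ^ i - q ^ j))).mul_right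
      (∏ t ∈ Finset.range s, ∏ j ∈ Finset.range (m + 1), (1 - q ^ (j + (t + 1)))⁻¹)
    have hlast : (∏ t ∈ Finset.range s, ∏ j ∈ Finset.range (m + 1), (1 - q ^ (j + (t + 1)))⁻¹) =
        ∏ i ∈ Finset.range (m + 1), ∏ j ∈ Finset.Icc 1 (s + k - k), 1 / (1 - q ^ (i + j)) := by
      rw [Finset.prod_comm]
      refine Finset.prod_congr rfl fun i _ => ?_
      rw [prod_Icc_one_add _ 0, Nat.add_sub_cancel, ← Finset.range_eq_Ico]
      simp
    rw [almostSquareGF, ← hlast]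
    rw [← hfib.unique (h.of_eq fun c => ?_)]
    · exact hsum.hasSum
    · rw [qAlternant_constDiagonal_div hq0 hq hkm, hval]
      ring
  exact (((toDiagArray_injective hk hkm).hasSum_iff hrange).mpr hGF).of_eq fun T => (hcomp T).symm

/-! ### Rankings of independent geometric entries -/

section ranking

variable {ι κ : Type*} [LinearOrder κ]

/-- The filling `T` lists the elements of `ι` in the order prescribed by `σ`, decreasingly. -/
def IsRankedBy (σ : ι ≃ κ) (T : ι → ℕ) : Prop :=
  ∀ a b, σ a < σ b ↔ T b < T a

theorem IsRankedBy.injective {σ : ι ≃ κ} {T : ι → ℕ} (h : IsRankedBy σ T) :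
    Function.Injective T := by
  intro a b hab
  by_contra hne
  rcases lt_or_gt_of_ne (σ.injective.ne hne) with h' | h'
  · exact absurd ((h a b).mp h') hab.not_gt
  · exact absurd ((h b a).mp h') hab.not_lt

theorem IsRankedBy.unique [Fintype κ] {σ σ' : ι ≃ κ} {T : ι → ℕ} (h : IsRankedBy σ T)
    (h' : IsRankedBy σ' T) : σ = σ' := by
  have hmono : StrictMono (σ.symm.trans σ') := by
    intro x y hxy
    simp only [Equiv.trans_apply]
    rw [h' _ _, ← h _ _]
    simpa using hxy
  have he : hmono.orderIsoOfSurjective _ (σ.symm.trans σ').surjective = OrderIso.refl κ :=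
    Subsingleton.elim _ _
  ext a
  have := congrArg (fun e : κ ≃o κ => e (σ a)) he
  simpa using this.symm

theorem exists_isRankedBy [Fintype ι] [Fintype κ] (hcard : Fintype.card ι = Fintype.card κ) {T : ι → ℕ}
    (hT : Function.Injective T) : ∃ σ : ι ≃ κ, IsRankedBy σ T := by
  let _ : LinearOrder ι :=
    LinearOrder.lift' (fun a => OrderDual.toDual (T a)) (OrderDual.toDual.injective.comp hT)
  let e : ι ≃o κ := (Fintype.orderIsoFinOfCardEq ι hcard).symm.trans
    (Fintype.orderIsoFinOfCardEq κ rfl)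
  exact ⟨e.toEquiv, fun a b => e.lt_iff_lt.trans Iff.rfl⟩

theorem isRankedBy_comp (σ σ' : ι ≃ κ) (T : ι → ℕ) :
    IsRankedBy σ' (T ∘ (σ'.trans σ.symm)) ↔ IsRankedBy σ T := by
  constructor
  · intro h a b
    simpa using h (σ'.symm (σ a)) (σ'.symm (σ b))
  · intro h a b
    simpa using h (σ.symm (σ' a)) (σ.symm (σ' b))

end ranking

section geometric

variable {ι : Type*} [Fintype ι] {q : ℝ}

/-- The probability of `T` when the entries are independent and geometric. -/
noncomputable def geometricWeight (q : ℝ) (T : ι → ℕ) : ℝ :=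
  (1 - q) ^ Fintype.card ι * q ^ ∑ i, T i

theorem hasSum_geometricWeight (hq0 : 0 < q) (hq : q < 1) :
    HasSum (geometricWeight q : (ι → ℕ) → ℝ) 1 := by
  have h := (hasSum_pow_sum (ι := ι) (q := q) (by rwa [Real.norm_of_nonneg hq0.le])).mul_left
    ((1 - q) ^ Fintype.card ι)
  rwa [← mul_pow, mul_inv_cancel₀ (sub_pos.mpr hq).ne', one_pow] at h

theorem geometricWeight_nonneg (hq0 : 0 < q) (hq : q < 1) (T : ι → ℕ) :
    0 ≤ geometricWeight q T :=
  mul_nonneg (pow_nonneg (sub_nonneg.mpr hq.le) _) (pow_nonneg hq0.le _)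

/-- The probability of an event when the entries are independent and geometric. -/
noncomputable def geometricProb (q : ℝ) (S : Set (ι → ℕ)) : ℝ :=
  ∑' T, S.indicator (geometricWeight q) T

theorem hasSum_geometricProb (hq0 : 0 < q) (hq : q < 1) (S : Set (ι → ℕ)) :
    HasSum (S.indicator (geometricWeight q)) (geometricProb q S) :=
  ((hasSum_geometricWeight hq0 hq).summable.indicator S).hasSum

theorem geometricProb_nonneg (hq0 : 0 < q) (hq : q < 1) (S : Set (ι → ℕ)) :
    0 ≤ geometricProb q S :=
  tsum_nonneg fun T => Set.indicator_nonneg (fun T _ => geometricWeight_nonneg hq0 hq T) T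

theorem geometricProb_mono (hq0 : 0 < q) (hq : q < 1) {S S' : Set (ι → ℕ)} (h : S ⊆ S') :
    geometricProb q S ≤ geometricProb q S' :=
  hasSum_le (Set.indicator_le_indicator_of_subset h (geometricWeight_nonneg hq0 hq))
    (hasSum_geometricProb hq0 hq S) (hasSum_geometricProb hq0 hq S')

/-- Given the entries other than `T b`, the event prescribes `T b = T a`, which has probability `(1
- q) * q ^ T a ≤ 1 - q`. -/
theorem geometricProb_eq_le (hq0 : 0 < q) (hq : q < 1) {a b : ι} (hab : a ≠ b) :
    geometricProb q {T : ι → ℕ | T a = T b} ≤ 1 - q := by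
  classical
  set g : ({j // j ≠ b} → ℕ) → ι → ℕ := fun T' =>
    (Equiv.funSplitAt b ℕ).symm (T' ⟨a, hab⟩, T') with hg
  have hgb : ∀ T', g T' b = T' ⟨a, hab⟩ := fun T' => by simp [hg]
  have hgne : ∀ T' (j : {j // j ≠ b}), g T' j = T' j := fun T' j => by
    simp [hg, j.2]
  have hinj : Function.Injective g := by
    intro T₁ T₂ h
    funext j
    rw [← hgne T₁, ← hgne T₂, h]
  have hran : ∀ T ∉ Set.range g,
      Set.indicator {T : ι → ℕ | T a = T b} (geometricWeight q) T = 0 := by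
    refine fun T hT => Set.indicator_of_notMem (fun h => hT ⟨fun j => T j, ?_⟩) _
    funext j
    by_cases hj : j = b
    · rw [hj]
      exact (hgb fun j => T j).trans h
    · exact hgne (fun j => T j) ⟨j, hj⟩
  have h1 := (hinj.hasSum_iff hran).mpr (hasSum_geometricProb hq0 hq {T : ι → ℕ | T a = T b})
  have h2 := (hasSum_geometricWeight (ι := {j // j ≠ b}) hq0 hq).mul_left (1 - q)
  rw [mul_one] at h2
  refine hasSum_le (fun T' => ?_) h1 h2
  have hsum : ∑ i, g T' i = T' ⟨a, hab⟩ + ∑ j, T' j := by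
    rw [Fintype.sum_eq_add_sum_subtype_ne _ b, hgb]
    simp only [hgne]
  have hcard : Fintype.card ι = Fintype.card {j // j ≠ b} + 1 := by
    have : 0 < Fintype.card ι := Fintype.card_pos_iff.mpr ⟨a⟩
    rw [Fintype.card_subtype_compl, Fintype.card_subtype_eq]
    omega
  have hw : geometricWeight q (g T') = (1 - q) * (q ^ T' ⟨a, hab⟩ * geometricWeight q T') := by
    rw [geometricWeight, geometricWeight, hsum, hcard, pow_succ, pow_add]
    ring
  have h0 := geometricWeight_nonneg hq0 hq T'
  refine (Set.indicator_le_self' (fun _ _ => geometricWeight_nonneg hq0 hq _) _).trans ?_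
  rw [hw]
  exact mul_le_mul_of_nonneg_left (mul_le_of_le_one_left h0 (pow_le_one₀ hq0.le hq.le))
    (sub_nonneg.mpr hq.le)

theorem geometricProb_not_injective_le (hq0 : 0 < q) (hq : q < 1) :
    geometricProb q {T : ι → ℕ | ¬ Function.Injective T} ≤
      (Fintype.card (ι × ι) : ℝ) * (1 - q) := by
  classical
  have h := hasSum_sum (s := (Finset.univ : Finset (ι × ι)).filter fun p => p.1 ≠ p.2)
    fun p _ => hasSum_geometricProb hq0 hq {T : ι → ℕ | T p.1 = T p.2}
  refine (hasSum_le (fun T => ?_) (hasSum_geometricProb hq0 hq _) h).trans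
    ((Finset.sum_le_card_nsmul _ _ (1 - q) fun p hp => ?_).trans ?_)
  · have hnn : ∀ p ∈ (Finset.univ : Finset (ι × ι)).filter fun p => p.1 ≠ p.2,
        0 ≤ Set.indicator {T : ι → ℕ | T p.1 = T p.2} (geometricWeight q) T := fun p _ =>
      Set.indicator_nonneg (fun T _ => geometricWeight_nonneg hq0 hq T) T
    by_cases hT : Function.Injective T
    · rw [Set.indicator_of_notMem fun h : T ∈ {T : ι → ℕ | ¬ Function.Injective T} => h hT]
      exact Finset.sum_nonneg hnn
    · rw [Set.indicator_of_mem (show T ∈ {T : ι → ℕ | ¬ Function.Injective T} from hT)]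
      obtain ⟨a, b, hab, hne⟩ : ∃ a b, T a = T b ∧ a ≠ b := by
        simpa [Function.Injective] using hT
      have := Finset.single_le_sum hnn (a := (a, b)) (by simpa using hne)
      rwa [Set.indicator_of_mem (show T ∈ {T : ι → ℕ | T a = T b} from hab)] at this
  · exact geometricProb_eq_le hq0 hq (by simpa using hp)
  · rw [nsmul_eq_mul]
    refine mul_le_mul_of_nonneg_right ?_ (sub_nonneg.mpr hq.le)
    exact_mod_cast Finset.card_le_univ _

variable {κ : Type*} [LinearOrder κ]

/-- The weight depends only on the sum of the entries, so permuting the positions carries one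
ranking to another with equal probability. -/
theorem geometricProb_isRankedBy (hq0 : 0 < q) (hq : q < 1) (σ σ' : ι ≃ κ) :
    geometricProb q {T | IsRankedBy σ T} = geometricProb q {T | IsRankedBy σ' T} := by
  refine (hasSum_geometricProb hq0 hq {T | IsRankedBy σ T}).unique ?_
  set π : ι ≃ ι := σ'.trans σ.symm with hπ
  have h := ((π.symm.arrowCongr (Equiv.refl ℕ)).hasSum_iff).mpr
    (hasSum_geometricProb hq0 hq {T | IsRankedBy σ' T})
  refine h.of_eq fun T => ?_
  have hT : (π.symm.arrowCongr (Equiv.refl ℕ)) T = T ∘ π := rfl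
  have hw : geometricWeight q (T ∘ π) = geometricWeight q T := by
    simp only [geometricWeight, Function.comp_apply, Equiv.sum_comp π T]
  rw [Function.comp_apply, hT]
  by_cases hm : IsRankedBy σ T
  · rw [Set.indicator_of_mem (by exact (isRankedBy_comp σ σ' T).mpr hm),
      Set.indicator_of_mem (by exact hm), hw]
  · rw [Set.indicator_of_notMem (by exact fun h => hm ((isRankedBy_comp σ σ' T).mp h)),
      Set.indicator_of_notMem (by exact hm)]

/-- An event on which injective fillings are decided by their ranking. -/
theorem geometricProb_eq_sum_isRankedBy [Fintype κ] (hcard : Fintype.card ι = Fintype.card κ)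
    (hq0 : 0 < q) (hq : q < 1) (S : Set (ι → ℕ)) (R : Set (ι ≃ κ))
    (h : ∀ σ T, IsRankedBy σ T → (T ∈ S ↔ σ ∈ R)) (σ₀ : ι ≃ κ) :
    geometricProb q S = Nat.card R * geometricProb q {T | IsRankedBy σ₀ T} +
      geometricProb q (S ∩ {T | ¬ Function.Injective T}) := by
  classical
  have hR := hasSum_sum (s := (Finset.univ : Finset (ι ≃ κ)).filter (· ∈ R))
    fun σ _ => hasSum_geometricProb hq0 hq {T : ι → ℕ | IsRankedBy σ T}
  rw [Finset.sum_congr rfl fun σ _ => geometricProb_isRankedBy hq0 hq σ σ₀, Finset.sum_const,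
    nsmul_eq_mul, ← Fintype.card_subtype, ← Nat.card_eq_fintype_card] at hR
  refine (hasSum_geometricProb hq0 hq S).unique
    ((hR.add (hasSum_geometricProb hq0 hq (S ∩ {T | ¬ Function.Injective T}))).of_eq fun T => ?_)
  by_cases hT : Function.Injective T
  · obtain ⟨σ, hσ⟩ := exists_isRankedBy hcard hT
    rw [Set.indicator_of_notMem fun h : T ∈ S ∩ {T | ¬ Function.Injective T} => h.2 hT, add_zero]
    have hz : ∀ σ' ≠ σ, Set.indicator {T : ι → ℕ | IsRankedBy σ' T} (geometricWeight q) T = 0 :=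
      fun σ' hne => Set.indicator_of_notMem (fun h' => hne (IsRankedBy.unique h' hσ)) _
    by_cases hS : T ∈ S
    · rw [Finset.sum_eq_single_of_mem σ (by simpa using (h σ T hσ).mp hS) fun σ' _ => hz σ',
        Set.indicator_of_mem hS, Set.indicator_of_mem (by exact hσ)]
    · rw [Set.indicator_of_notMem hS]
      refine Finset.sum_eq_zero fun σ' hσ' => hz σ' ?_
      rintro rfl
      exact hS ((h σ' T hσ).mpr (by simpa using hσ'))
  · rw [Finset.sum_eq_zero fun σ _ => Set.indicator_of_notMem (fun h' => hT
      (IsRankedBy.injective h')) _, zero_add]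
    by_cases hS : T ∈ S
    · rw [Set.indicator_of_mem hS, Set.indicator_of_mem (by exact ⟨hS, hT⟩)]
    · rw [Set.indicator_of_notMem hS, Set.indicator_of_notMem fun h => hS h.1]

open Filter Topology in
theorem tendsto_geometricProb [Fintype κ] (hcard : Fintype.card ι = Fintype.card κ)
    (S : Set (ι → ℕ)) (R : Set (ι ≃ κ)) (h : ∀ σ T, IsRankedBy σ T → (T ∈ S ↔ σ ∈ R)) :
    Tendsto (fun q => geometricProb q S) (𝓝[<] 1) (𝓝 (Nat.card R / (Fintype.card ι)! : ℝ)) := by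
  classical
  let σ₀ : ι ≃ κ := Fintype.equivOfCardEq hcard
  have hev : ∀ᶠ q : ℝ in 𝓝[<] 1, 0 < q ∧ q < 1 :=
    Ioo_mem_nhdsLT (show (0 : ℝ) < 1 by norm_num)
  have hlim : Tendsto (fun q : ℝ => (Fintype.card (ι × ι) : ℝ) * (1 - q)) (𝓝[<] 1) (𝓝 0) := by
    refine (Continuous.tendsto' (by fun_prop) 1 0 (by simp)).mono_left nhdsWithin_le_nhds
  have hni : ∀ S' : Set (ι → ℕ), S' ⊆ {T | ¬ Function.Injective T} →
      Tendsto (fun q => geometricProb q S') (𝓝[<] 1) (𝓝 0) := fun S' hS' =>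
    tendsto_of_tendsto_of_tendsto_of_le_of_le' tendsto_const_nhds hlim
      (hev.mono fun q hq => geometricProb_nonneg hq.1 hq.2 _)
      (hev.mono fun q hq => (geometricProb_mono hq.1 hq.2 hS').trans
        (geometricProb_not_injective_le hq.1 hq.2))
  have hfac : ((Fintype.card ι)! : ℝ) ≠ 0 := by positivity
  -- Taking the whole space as the event, the `(Fintype.card ι)!` equal probabilities sum to the
  -- probability of having no ties.
  have hall : ∀ᶠ q : ℝ in 𝓝[<] 1, (1 - geometricProb q {T : ι → ℕ | ¬ Function.Injective T}) /
      (Fintype.card ι)! = geometricProb q {T | IsRankedBy σ₀ T} := by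
    filter_upwards [hev] with q hq
    have h1 := geometricProb_eq_sum_isRankedBy hcard hq.1 hq.2 Set.univ Set.univ
      (fun _ _ _ => by simp) σ₀
    have h2 : geometricProb q (Set.univ : Set (ι → ℕ)) = 1 := by
      rw [geometricProb, Set.indicator_univ]
      exact (hasSum_geometricWeight hq.1 hq.2).tsum_eq
    rw [h2, Set.univ_inter, Nat.card_univ, Nat.card_eq_fintype_card, Fintype.card_equiv σ₀] at h1
    rw [div_eq_iff hfac]
    linarith
  have hrank : Tendsto (fun q => geometricProb q {T | IsRankedBy σ₀ T}) (𝓝[<] 1)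
      (𝓝 ((1 - 0) / (Fintype.card ι)!)) :=
    ((tendsto_const_nhds.sub (hni _ subset_rfl)).div_const _).congr' hall
  have hfin := (hrank.const_mul (Nat.card R : ℝ)).add (hni (S ∩ {T | ¬ Function.Injective T})
    Set.inter_subset_right)
  rw [sub_zero, add_zero, mul_one_div] at hfin
  refine hfin.congr' ?_
  filter_upwards [hev] with q hq
  exact (geometricProb_eq_sum_isRankedBy hcard hq.1 hq.2 S R h σ₀).symm

end geometric

open Filter Topology in
/-- The leading asymptotics of the generating function of plane partitions counts standard
tableaux. -/
theorem tendsto_planePartition_tsum (D : Finset (ℕ × ℕ)) :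
    Tendsto (fun q : ℝ => (1 - q) ^ D.card *
      ∑' T : {T : D → ℕ // IsPlanePartition D T}, q ^ ∑ c, T.1 c) (𝓝[<] 1)
      (𝓝 (numStandardTableaux D / (D.card)! : ℝ)) := by
  have h := tendsto_geometricProb (ι := D) (κ := Finset.Icc 1 D.card) (by simp)
    {T | IsPlanePartition D T} {σ | IsStandardTableau D σ} fun σ T hσ => ?_
  · rw [Fintype.card_coe] at h
    refine h.congr fun q => ?_
    rw [geometricProb, ← tsum_subtype, ← tsum_mul_left]
    refine tsum_congr fun T => ?_
    rw [geometricWeight, Fintype.card_coe]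
  -- Without ties weak inequalities are strict, and the ranking reverses order: the largest entry
  -- receives the label `1`.
  · have key : ∀ a b : D, a ≠ b → (T b ≤ T a ↔ (σ a : ℕ) < σ b) := by
      intro a b hab
      have h1 : (σ a : ℕ) < σ b ↔ T b < T a := hσ a b
      rw [h1]
      exact ⟨fun h' => lt_of_le_of_ne h' fun he => hab (hσ.injective he.symm), le_of_lt⟩
    refine and_congr ?_ ?_
    · refine forall_congr' fun a => forall_congr' fun b => imp_congr_right fun _ =>
        imp_congr_right fun hlt => key a b ?_
      rintro rfl
      exact lt_irrefl _ hlt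
    · refine forall_congr' fun a => forall_congr' fun b => imp_congr_right fun _ =>
        imp_congr_right fun hlt => key a b ?_
      rintro rfl
      exact lt_irrefl _ hlt

/-! ### The limit of the generating function as q tends to 1 -/

section asymptotics

open Filter Topology

theorem tendsto_ofReal_one : Tendsto (fun q : ℝ => (q : ℂ)) (𝓝[<] 1) (𝓝 1) :=
  (Complex.continuous_ofReal.tendsto' 1 1 Complex.ofReal_one).mono_left nhdsWithin_le_nhds

theorem eventually_mem_Ioo : ∀ᶠ q : ℝ in 𝓝[<] 1, 0 < q ∧ q < 1 :=
  Ioo_mem_nhdsLT (show (0 : ℝ) < 1 by norm_num)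

theorem tendsto_one_sub_div_one_sub_pow (a : ℕ) :
    Tendsto (fun q : ℝ => (1 - (q : ℂ)) * (1 / (1 - (q : ℂ) ^ (a + 1)))) (𝓝[<] 1)
      (𝓝 (1 / ((a + 1 : ℕ) : ℂ))) := by
  have hc : Continuous fun x : ℂ => ∑ i ∈ Finset.range (a + 1), x ^ i := by fun_prop
  have h := (hc.tendsto' 1 ((a + 1 : ℕ) : ℂ) (by simp)).comp tendsto_ofReal_one
  have h' := h.inv₀ (Nat.cast_ne_zero.mpr (Nat.succ_ne_zero a))
  rw [one_div]
  refine h'.congr' ?_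
  filter_upwards [eventually_mem_Ioo] with q hq
  have h1 : (1 : ℂ) - q ≠ 0 := by
    rw [sub_ne_zero]
    exact_mod_cast hq.2.ne'
  rw [Function.comp_apply, ← mul_neg_geom_sum, one_div, mul_inv, mul_inv_cancel_left₀ h1]

theorem tendsto_one_sub_div_pow_sub_pow {i j : ℕ} (hij : j < i) :
    Tendsto (fun q : ℝ => (1 - (q : ℂ)) * (1 / ((q : ℂ) ^ i - (q : ℂ) ^ j))) (𝓝[<] 1)
      (𝓝 (-(1 / ((i - j : ℕ) : ℂ)))) := by
  obtain ⟨t, rfl⟩ := Nat.exists_eq_add_of_lt hij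
  have h1 := (tendsto_ofReal_one.pow j).inv₀ (by simp)
  have h := (h1.mul (tendsto_one_sub_div_one_sub_pow t)).neg
  rw [one_pow, inv_one, one_mul, show t + 1 = j + t + 1 - j by omega] at h
  refine h.congr fun q => ?_
  rw [show j + t + 1 - j = t + 1 by omega, add_assoc, pow_add _ j (t + 1),
    show (q : ℂ) ^ j * q ^ (t + 1) - q ^ j = -(q ^ j * (1 - q ^ (t + 1))) by ring, one_div, one_div,
    inv_neg, mul_inv]
  ring

theorem continuous_coeff_prod {ι X : Type*} [TopologicalSpace X] (s : Finset ι)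
    (P : ι → X → Polynomial ℂ) (h : ∀ i ∈ s, ∀ r, Continuous fun x => (P i x).coeff r) (r : ℕ) :
    Continuous fun x => (∏ i ∈ s, P i x).coeff r := by
  classical
  induction s using Finset.induction_on generalizing r with
  | empty => simpa using continuous_const
  | insert i s hi ih =>
    simp only [Finset.prod_insert hi, Polynomial.coeff_mul]
    exact continuous_finsetSum _ fun p _ => (h i (Finset.mem_insert_self i s) _).mul
      (ih (fun j hj => h j (Finset.mem_insert_of_mem hj)) _)

/-- The nontrivial factor of `almostSquarePoly`. -/
noncomputable def almostSquareFactor (m k : ℕ) (q : ℂ) : Polynomial ℂ :=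
  ∏ i ∈ Finset.Icc 1 k, ∏ j ∈ Finset.Icc (k + 1) m,
    (Polynomial.X * Polynomial.C (q ^ (m - i)) - Polynomial.C (q ^ (m - j)))

theorem continuous_coeff_almostSquareFactor (m k r : ℕ) :
    Continuous fun q => (almostSquareFactor m k q).coeff r := by
  refine continuous_coeff_prod _ _ (fun i _ => continuous_coeff_prod _ _ fun j _ r => ?_) r
  simp only [Polynomial.coeff_sub, Polynomial.coeff_mul_C, Polynomial.coeff_X, Polynomial.coeff_C]
  split_ifs <;> fun_prop

theorem natDegree_almostSquareFactor_le (m k : ℕ) (q : ℂ) :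
    (almostSquareFactor m k q).natDegree ≤ k * (m - k) := by
  have h : ∀ i ∈ Finset.Icc 1 k, (∏ j ∈ Finset.Icc (k + 1) m,
      (Polynomial.X * Polynomial.C (q ^ (m - i)) - Polynomial.C (q ^ (m - j)))).natDegree ≤
        m - k := by
    intro i _
    refine (Polynomial.natDegree_prod_le _ _).trans
      ((Finset.sum_le_card_nsmul _ _ 1 fun j _ => ?_).trans (by simp))
    compute_degree
  refine (Polynomial.natDegree_prod_le _ _).trans
    ((Finset.sum_le_card_nsmul _ _ (m - k) h).trans (by simp))

theorem almostSquareFactor_one (m k : ℕ) :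
    almostSquareFactor m k 1 = (Polynomial.X - 1) ^ (k * (m - k)) := by
  simp [almostSquareFactor, ← pow_mul, mul_comm]

/-- The degree may vary with `q`; a range independent of `q` is needed to take limits term by term.
-/
theorem sum_coeff_almostSquarePoly (m k : ℕ) (q : ℂ) (g : ℕ → ℂ) :
    ∑ r ∈ Finset.range ((almostSquarePoly m k q).natDegree + 1),
        (almostSquarePoly m k q).coeff r * g r =
      ∑ t ∈ Finset.range (k * (m - k) + 1), (almostSquareFactor m k q).coeff t *
        g (k.choose 2 + t) := by
  have hP : almostSquarePoly m k q = Polynomial.X ^ k.choose 2 * almostSquareFactor m k q := rfl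
  have hdeg : (almostSquarePoly m k q).natDegree < k.choose 2 + (k * (m - k) + 1) := by
    rw [hP]
    refine lt_of_le_of_lt Polynomial.natDegree_mul_le ?_
    rw [Polynomial.natDegree_X_pow]
    have := natDegree_almostSquareFactor_le m k q
    omega
  rw [← Polynomial.sum_over_range _ (f := fun r c => c * g r) (by simp),
    Polynomial.sum_over_range' _ (by simp) _ hdeg, Finset.sum_range_add,
    Finset.sum_eq_zero, zero_add]
  · refine Finset.sum_congr rfl fun t _ => ?_
    rw [hP, add_comm _ t, Polynomial.coeff_X_pow_mul]
  · intro r hr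
    rw [hP, Polynomial.coeff_X_pow_mul', if_neg (by simpa using hr), zero_mul]

/-- The beta integral `∫ x ^ a (x - 1) ^ b`, as a sum over coefficients. -/
theorem sum_coeff_X_sub_one_pow (b a : ℕ) :
    ∑ t ∈ Finset.range (b + 1), ((Polynomial.X - 1 : Polynomial ℂ) ^ b).coeff t *
      (1 / ((t + a + 1 : ℕ) : ℂ)) = (-1) ^ b * (a ! * b ! / (a + b + 1)!) := by
  induction b generalizing a with
  | zero =>
    have : ((a + 1 : ℕ) : ℂ) ≠ 0 := Nat.cast_ne_zero.mpr (Nat.succ_ne_zero a)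
    have h2 : ((a ! : ℕ) : ℂ) ≠ 0 := Nat.cast_ne_zero.mpr (Nat.factorial_ne_zero a)
    simp only [zero_add, Finset.sum_range_one, pow_zero, Polynomial.coeff_one_zero, add_zero,
      Nat.factorial_zero, Nat.factorial_succ]
    push_cast at *
    field_simp
  | succ b ih =>
    have hd : ((Polynomial.X - 1 : Polynomial ℂ) ^ b).coeff (b + 1) = 0 := by
      refine Polynomial.coeff_eq_zero_of_natDegree_lt ?_
      rw [← Polynomial.C_1, Polynomial.natDegree_pow, Polynomial.natDegree_X_sub_C]
      omega
    -- With $I(a,b)=\int_0^1 x^a(x-1)^b\,dx$, this is the recursion $I(a,b+1)=I(a+1,b)-I(a,b)$.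
    simp only [pow_succ, mul_sub, mul_one, Polynomial.coeff_sub, sub_mul, Finset.sum_sub_distrib]
    rw [Finset.sum_range_succ', Finset.sum_range_succ _ (b + 1), hd, ih a]
    simp only [Polynomial.coeff_mul_X, Polynomial.mul_coeff_zero, Polynomial.coeff_X_zero]
    have h1 := ih (a + 1)
    simp only [← add_assoc, add_right_comm a 1 b] at h1
    simp only [add_right_comm _ 1 a]
    rw [h1]
    simp only [← add_assoc, Nat.factorial_succ]
    have e1 : ((a + b + 1 : ℕ) : ℂ) ≠ 0 := Nat.cast_ne_zero.mpr (Nat.succ_ne_zero _)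
    have e2 : ((a + b + 1 + 1 : ℕ) : ℂ) ≠ 0 := Nat.cast_ne_zero.mpr (Nat.succ_ne_zero _)
    have e3 : (((a + b) ! : ℕ) : ℂ) ≠ 0 := Nat.cast_ne_zero.mpr (Nat.factorial_ne_zero _)
    push_cast at *
    field_simp
    ring

/-- The product of the hook lengths of the `a × b` rectangle. -/
def rectHookProd (a b : ℕ) : ℕ :=
  ∏ i ∈ Finset.range a, ∏ j ∈ Finset.range b, (i + j + 1)

theorem rectHookProd_ne_zero (a b : ℕ) : rectHookProd a b ≠ 0 :=
  Finset.prod_ne_zero_iff.mpr fun _ _ => Finset.prod_ne_zero_iff.mpr fun _ _ => Nat.succ_ne_zero _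

theorem rectHookProd_comm (a b : ℕ) : rectHookProd a b = rectHookProd b a := by
  rw [rectHookProd, Finset.prod_comm]
  simp only [rectHookProd, add_comm]

/-- Each simple pole absorbs one factor `1 - q`: one for the sum over $r$, `k * (m - k)` for the
mixed product, `m * s` for the last. The signs of the beta integral and of the mixed product cancel.
-/
theorem tendsto_almostSquareGF {m s k : ℕ} (hk : 1 ≤ k) (hkm : k ≤ m) :
    Tendsto (fun q : ℝ => (1 - (q : ℂ)) ^ (m * s + k * (m - k) + 1) *
        almostSquareGF m (s + k) k q) (𝓝[<] 1)
      (𝓝 (((k * s)! * (k * (m - k))! / (k * s + k * (m - k) + 1)! : ℂ) *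
        (1 / rectHookProd k (m - k)) * (1 / rectHookProd m s))) := by
  set p := m - k with hp
  have h1 : Tendsto (fun q : ℝ => ∑ t ∈ Finset.range (k * p + 1),
      (almostSquareFactor m k q).coeff t *
        ((1 - (q : ℂ)) * (1 / (1 - (q : ℂ) ^ (t + k * s + 1))))) (𝓝[<] 1)
      (𝓝 ((-1) ^ (k * p) * ((k * s)! * (k * p)! / (k * s + k * p + 1)!))) := by
    rw [← sum_coeff_X_sub_one_pow, ← almostSquareFactor_one]
    exact tendsto_finsetSum _ fun t _ =>
      (((continuous_coeff_almostSquareFactor m k t).tendsto 1).comp tendsto_ofReal_one).mul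
        (tendsto_one_sub_div_one_sub_pow _)
  have h2 : Tendsto (fun q : ℝ => ∏ i ∈ Finset.Ico p m, ∏ j ∈ Finset.range p,
      (1 - (q : ℂ)) * (1 / ((q : ℂ) ^ i - (q : ℂ) ^ j))) (𝓝[<] 1)
      (𝓝 (∏ i ∈ Finset.Ico p m, ∏ j ∈ Finset.range p, -(1 / ((i - j : ℕ) : ℂ)))) := by
    refine tendsto_finsetProd _ fun i hi => tendsto_finsetProd _ fun j hj => ?_
    rw [Finset.mem_Ico] at hi
    rw [Finset.mem_range] at hj
    exact tendsto_one_sub_div_pow_sub_pow (by omega)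
  have h3 : Tendsto (fun q : ℝ => ∏ i ∈ Finset.range m, ∏ j ∈ Finset.range s,
      (1 - (q : ℂ)) * (1 / (1 - (q : ℂ) ^ (i + j + 1)))) (𝓝[<] 1)
      (𝓝 (∏ i ∈ Finset.range m, ∏ j ∈ Finset.range s, 1 / ((i + j + 1 : ℕ) : ℂ))) :=
    tendsto_finsetProd _ fun i _ => tendsto_finsetProd _ fun j _ =>
      tendsto_one_sub_div_one_sub_pow _
  have hv2 : (∏ i ∈ Finset.Ico p m, ∏ j ∈ Finset.range p, -(1 / ((i - j : ℕ) : ℂ))) =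
      (-1) ^ (k * p) * (1 / rectHookProd k p) := by
    have hmk : m = p + k := by omega
    rw [hmk, Finset.prod_Ico_eq_prod_range, Nat.add_sub_cancel_left]
    have e : ∀ i ∈ Finset.range k, (∏ j ∈ Finset.range p, -(1 / ((p + i - j : ℕ) : ℂ))) =
        (-1) ^ p * ∏ j ∈ Finset.range p, 1 / ((i + j + 1 : ℕ) : ℂ) := by
      intro i _
      rw [Finset.prod_neg, Finset.card_range,
        ← Finset.prod_range_reflect (fun j => 1 / ((i + j + 1 : ℕ) : ℂ))]
      congr 1
      refine Finset.prod_congr rfl fun j hj => ?_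
      rw [Finset.mem_range] at hj
      congr 3
      omega
    rw [Finset.prod_congr rfl e, Finset.prod_mul_distrib, Finset.prod_const, Finset.card_range,
      ← pow_mul, mul_comm p k]
    simp [rectHookProd]
  have hv3 : (∏ i ∈ Finset.range m, ∏ j ∈ Finset.range s, 1 / ((i + j + 1 : ℕ) : ℂ)) =
      1 / rectHookProd m s := by
    simp [rectHookProd]
  rw [hv2] at h2
  rw [hv3] at h3
  have h := (h1.mul h2).mul h3
  rw [show ((-1 : ℂ) ^ (k * p) * ((k * s)! * (k * p)! / (k * s + k * p + 1)!)) *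
      ((-1) ^ (k * p) * (1 / rectHookProd k p)) * (1 / rectHookProd m s) =
      ((-1 : ℂ) * (-1)) ^ (k * p) * (((k * s)! * (k * p)! / (k * s + k * p + 1)!) *
      (1 / rectHookProd k p) * (1 / rectHookProd m s)) by rw [mul_pow]; ring] at h
  rw [neg_one_mul, neg_neg, one_pow, one_mul] at h
  refine h.congr fun q => ?_
  rw [almostSquareGF, sum_coeff_almostSquarePoly, ← hp, Nat.add_sub_cancel]
  have e1 : ∀ t : ℕ, (q : ℂ) ^ (((k.choose 2 + t : ℕ) : ℤ) + k * (s + k : ℕ) - k ^ 2 -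
      k.choose 2 + 1) = (q : ℂ) ^ (t + k * s + 1) := by
    intro t
    rw [← zpow_natCast]
    congr 1
    push_cast
    ring
  have e3 : ∏ i ∈ Finset.range m, ∏ j ∈ Finset.Icc 1 s, 1 / (1 - (q : ℂ) ^ (i + j)) =
      ∏ i ∈ Finset.range m, ∏ j ∈ Finset.range s, 1 / (1 - (q : ℂ) ^ (i + j + 1)) := by
    refine Finset.prod_congr rfl fun i _ => ?_
    rw [prod_Icc_one_add _ 0, ← Finset.range_eq_Ico]
    rfl
  rw [e3]
  simp only [e1, Finset.prod_mul_distrib, Finset.prod_const, Finset.card_range, Nat.card_Ico,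
    mul_left_comm _ (1 - (q : ℂ)), ← Finset.mul_sum, ← pow_mul]
  rw [show m - p = k by omega, pow_succ, pow_add, mul_comm p k, mul_comm s m]
  ring

end asymptotics

/-! ### Counting standard tableaux -/

open Filter Topology in
/-- The product formula for almost-square truncated rectangles. -/
theorem numStandardTableaux_almostSquareDiagram {m s k : ℕ} (hk : 1 ≤ k) (hkm : k ≤ m) :
    numStandardTableaux (almostSquareDiagram m (s + k) k) * (rectHookProd m s *
        rectHookProd k (m - k) * (k * s + k * (m - k) + 1)!) =
      (m * s + k * (m - k) + 1)! * ((k * s)! * (k * (m - k))!) := by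
  set D := almostSquareDiagram m (s + k) k
  have h1 := (Complex.continuous_ofReal.tendsto _).comp (tendsto_planePartition_tsum D)
  have h2 := tendsto_almostSquareGF (s := s) hk hkm
  have h3 : ∀ᶠ q : ℝ in 𝓝[<] 1, (Complex.ofReal ∘ fun q : ℝ => (1 - q) ^ D.card *
      ∑' T : {T : D → ℕ // IsPlanePartition D T}, q ^ ∑ c, T.1 c) q =
      (1 - (q : ℂ)) ^ (m * s + k * (m - k) + 1) * almostSquareGF m (s + k) k q := by
    filter_upwards [eventually_mem_Ioo] with q hq
    have h := hasSum_almostSquareGF (q := (q : ℂ)) (n := s + k)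
      (Complex.ofReal_ne_zero.mpr hq.1.ne')
      (by rw [Complex.norm_real, Real.norm_of_nonneg hq.1.le]; exact hq.2) hk hkm (by omega)
    rw [← h.tsum_eq, ← card_almostSquareDiagram hk hkm]
    simp only [Function.comp_apply, Complex.ofReal_mul, Complex.ofReal_pow, Complex.ofReal_sub,
      Complex.ofReal_one, Complex.ofReal_tsum]
    rfl
  have h := tendsto_nhds_unique (h1.congr' h3) h2
  rw [card_almostSquareDiagram hk hkm] at h
  push_cast at h
  have hf1 : (((m * s + k * (m - k) + 1)! : ℕ) : ℂ) ≠ 0 :=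
    Nat.cast_ne_zero.mpr (Nat.factorial_ne_zero _)
  have hf2 : (((k * s + k * (m - k) + 1)! : ℕ) : ℂ) ≠ 0 :=
    Nat.cast_ne_zero.mpr (Nat.factorial_ne_zero _)
  have hf3 : ((rectHookProd k (m - k) : ℕ) : ℂ) ≠ 0 :=
    Nat.cast_ne_zero.mpr (rectHookProd_ne_zero _ _)
  have hf4 : ((rectHookProd m s : ℕ) : ℂ) ≠ 0 :=
    Nat.cast_ne_zero.mpr (rectHookProd_ne_zero _ _)
  rw [← @Nat.cast_inj ℂ]
  push_cast
  field_simp at h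
  linear_combination h

theorem numStandardTableaux_empty : numStandardTableaux ∅ = 1 := by
  have hu : ∀ T : (∅ : Finset (ℕ × ℕ)) ≃ Finset.Icc 1 (∅ : Finset (ℕ × ℕ)).card,
      IsStandardTableau ∅ T := fun T =>
    ⟨fun a => absurd a.2 (Finset.notMem_empty _), fun a => absurd a.2 (Finset.notMem_empty _)⟩
  have : Nonempty ((∅ : Finset (ℕ × ℕ)) ≃ Finset.Icc 1 (∅ : Finset (ℕ × ℕ)).card) :=
    ⟨Fintype.equivOfCardEq
      (by rw [Fintype.card_coe, Fintype.card_coe, Nat.card_Icc, Nat.add_sub_cancel])⟩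
  rw [numStandardTableaux, Nat.card_eq_one_iff_unique]
  refine ⟨⟨fun a b => Subtype.ext (Equiv.ext fun x => absurd x.2 (Finset.notMem_empty _))⟩, ?_⟩
  obtain ⟨T⟩ := this
  exact ⟨⟨T, hu T⟩⟩

theorem rectHookProd_one_left (b : ℕ) : rectHookProd 1 b = b ! := by
  simp [rectHookProd, Finset.prod_range_add_one_eq_factorial]

/-- The hooks of the added column multiply to `(a + b)! / b !`. This converts the `k = 1` count into
the hook length formula. -/
theorem rectHookProd_succ_right (a b : ℕ) :
    rectHookProd a (b + 1) * b ! = rectHookProd a b * (a + b)! := by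
  simp only [rectHookProd, Finset.prod_range_succ, Finset.prod_mul_distrib]
  rw [mul_assoc]
  congr 1
  induction a with
  | zero => simp
  | succ a ih =>
    rw [Finset.prod_range_succ, mul_right_comm, ih, show a + 1 + b = a + b + 1 by ring,
      Nat.factorial_succ, mul_comm]

/-- The hook length formula for rectangles. -/
theorem numStandardTableaux_rectangle (a b : ℕ) :
    numStandardTableaux (straightDiagram (List.replicate a b)) * rectHookProd a b = (a * b)! := by
  rcases Nat.eq_zero_or_pos a with rfl | ha
  · have : straightDiagram (List.replicate 0 b) = ∅ := rfl
    rw [this, numStandardTableaux_empty]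
    simp [rectHookProd]
  rcases Nat.eq_zero_or_pos b with rfl | hb
  · have : straightDiagram (List.replicate a 0) = ∅ := by
      ext c
      simp [straightDiagram, mem_truncatedDiagram, List.getD_eq_getElem?_getD,
        List.getElem?_replicate]
      split_ifs <;> simp
    rw [this, numStandardTableaux_empty]
    simp [rectHookProd]
  obtain ⟨b, rfl⟩ := Nat.exists_eq_add_of_le' hb
  -- For `k = 1` the removed part is empty, so the general count applies to the full rectangle.
  have hD : straightDiagram (List.replicate a (b + 1)) = almostSquareDiagram a (b + 1) 1 := by
    ext ⟨i, j⟩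
    rw [mem_almostSquareDiagram_iff le_rfl ha, straightDiagram, mem_truncatedDiagram]
    by_cases hi : i < a
    · simp [List.getD_eq_getElem?_getD, hi]
      omega
    · simp [List.getD_eq_getElem?_getD, hi]
      omega
  have h := numStandardTableaux_almostSquareDiagram (s := b) le_rfl ha
  have h2 := rectHookProd_succ_right a b
  rw [hD]
  obtain ⟨a, rfl⟩ := Nat.exists_eq_add_of_le' ha
  simp only [Nat.add_sub_cancel, one_mul, rectHookProd_one_left] at h
  rw [show b + a + 1 = a + 1 + b by ring, show (a + 1) * b + a + 1 = (a + 1) * (b + 1) by ring] at h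
  have hne : b ! * a ! ≠ 0 := mul_ne_zero (Nat.factorial_ne_zero _) (Nat.factorial_ne_zero _)
  apply Nat.eq_of_mul_eq_mul_right (Nat.pos_of_ne_zero hne)
  rw [← h, ← mul_assoc, mul_assoc _ (rectHookProd (a + 1) (b + 1)), h2]
  ring

theorem theorem3 (m n k : ℕ) (hk : 1 ≤ k) (hkm : k ≤ m) (hkn : k ≤ n) :
    (numStandardTableaux (almostSquareDiagram m n k) : ℚ) =
        ((n * m - k ^ 2 + 1).choose (m * (n - k)) : ℚ) *
          ((k * (m + n - 2 * k) + 1).choose (k * n - k ^ 2) : ℚ)⁻¹ *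
          numStandardTableaux (straightDiagram (List.replicate (n - k) m)) *
          numStandardTableaux (straightDiagram (List.replicate k (m - k))) ∧
      (2 * k - 1 ≤ n →
        (∀ q : ℂ, q ≠ 0 → ‖q‖ < 1 →
          HasSum
            (fun T : {T : almostSquareDiagram m n k → ℕ //
                IsPlanePartition (almostSquareDiagram m n k) T} => q ^ (∑ c, T.1 c))
            (almostSquareGF m n k q)) ∧
        (numStandardTableaux (almostSquareDiagram m n k) : ℚ) =
          ((n * m - k ^ 2 + 1)! : ℚ) *
              numStandardTableaux (straightDiagram (List.replicate (n - k) m)) /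
              (m * (n - k))! *
            (numStandardTableaux (straightDiagram (List.replicate k (m - k))) /
              ((m - k) * k)!) *
            (((k * n - k ^ 2)! : ℚ) * (k * (m - k))! /
              (m * k + k * n - 2 * k ^ 2 + 1)!)) := by
  obtain ⟨s, rfl⟩ := Nat.exists_eq_add_of_le' hkn
  have h1 := numStandardTableaux_almostSquareDiagram (s := s) hk hkm
  obtain ⟨p, rfl⟩ := Nat.exists_eq_add_of_le' hkm
  have h2 := numStandardTableaux_rectangle s (p + k)
  have h3 := numStandardTableaux_rectangle k p
  -- The shape $(m^{n-k})$ is the transpose of the `m × s` rectangle in the count; both have the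
  -- same hook product.
  rw [rectHookProd_comm] at h2
  rw [Nat.add_sub_cancel] at h1
  -- The subtractions are resolved into sums with second summand `k * p + 1`, so that both binomials
  -- have the form `(a + b).choose a`.
  have e1 : (s + k) * (p + k) - k ^ 2 + 1 = (p + k) * s + (k * p + 1) := by
    rw [show (s + k) * (p + k) = (p + k) * s + k * p + k ^ 2 by ring, Nat.add_sub_cancel, add_assoc]
  have e2 : k * (p + k + (s + k) - 2 * k) + 1 = k * s + (k * p + 1) := by
    rw [show p + k + (s + k) - 2 * k = s + p by omega]
    ring
  have e3 : k * (s + k) - k ^ 2 = k * s := by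
    rw [show k * (s + k) = k * s + k ^ 2 by ring, Nat.add_sub_cancel]
  have e4 : (p + k) * k + k * (s + k) - 2 * k ^ 2 + 1 = k * s + (k * p + 1) := by
    rw [show (p + k) * k + k * (s + k) = k * s + k * p + 2 * k ^ 2 by ring, Nat.add_sub_cancel,
      add_assoc]
  rw [e1, e2, e3, e4, Nat.add_sub_cancel, Nat.add_sub_cancel, mul_comm p k]
  rw [add_assoc, add_assoc] at h1
  rw [mul_comm s] at h2
  have hmain : (numStandardTableaux (almostSquareDiagram (p + k) (s + k) k) : ℚ) =
      (((p + k) * s + (k * p + 1))! : ℚ) *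
          numStandardTableaux (straightDiagram (List.replicate s (p + k))) / ((p + k) * s)! *
        (numStandardTableaux (straightDiagram (List.replicate k p)) / (k * p)!) *
        (((k * s)! : ℚ) * (k * p)! / (k * s + (k * p + 1))!) := by
    have hf1 : ((rectHookProd (p + k) s : ℕ) : ℚ) ≠ 0 :=
      Nat.cast_ne_zero.mpr (rectHookProd_ne_zero _ _)
    have hf2 : ((rectHookProd k p : ℕ) : ℚ) ≠ 0 := Nat.cast_ne_zero.mpr (rectHookProd_ne_zero _ _)
    have hg1 : ((((p + k) * s)! : ℕ) : ℚ) ≠ 0 := Nat.cast_ne_zero.mpr (Nat.factorial_ne_zero _)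
    have hg2 : (((k * p)! : ℕ) : ℚ) ≠ 0 := Nat.cast_ne_zero.mpr (Nat.factorial_ne_zero _)
    have hg3 : (((k * s + (k * p + 1))! : ℕ) : ℚ) ≠ 0 :=
      Nat.cast_ne_zero.mpr (Nat.factorial_ne_zero _)
    have h1' := congrArg (Nat.cast : ℕ → ℚ) h1
    have h2' := congrArg (Nat.cast : ℕ → ℚ) h2
    have h3' := congrArg (Nat.cast : ℕ → ℚ) h3
    rw [Nat.cast_mul] at h2' h3'
    simp only [Nat.cast_mul] at h1'
    rw [← eq_div_iff hf1] at h2'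
    rw [← eq_div_iff hf2] at h3'
    rw [h2', h3']
    field_simp
    linear_combination h1'
  refine ⟨?_, fun _ => ⟨fun q hq0 hq => hasSum_almostSquareGF hq0 hq hk hkm hkn, hmain⟩⟩
  rw [hmain, Nat.cast_add_choose, Nat.cast_add_choose]
  have hg (a : ℕ) : ((a ! : ℕ) : ℚ) ≠ 0 := Nat.cast_ne_zero.mpr (Nat.factorial_ne_zero _)
  have g1 := hg ((p + k) * s)
  have g2 := hg (k * p)
  have g3 := hg (k * s + (k * p + 1))
  have g4 := hg (k * p + 1)
  have g5 := hg (k * s)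
  field_simp
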